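/- Let $p$ be a prime. An analytic field is a field complete with respect to a multiplicative nonarchimedean norm; any finite extension $L$ of a (nontrivially normed) analytic field $K$ is an analytic field for the unique multiplicative extension of the norm. Write $\mathfrak{o}_K=\{x\in K:|x|\le 1\}$. An analytic field $K$ is of mixed characteristics if $|p|=p^{-1}$ and its residue field has characteristic $p$; it is perfectoid if it is of mixed characteristics, it is not discretely valued, and the $p$-th power map on $\mathfrak{o}_K/(p)$ is surjective. For $K$ of mixed characteristics, let $\mathfrak{o}_{K'}=\varprojlim_{x\mapsto x^p}\mathfrak{o}_K/(p)$, and let the perfect norm field (tilt) $K'$ be its fraction field, with the norm $|\cdot|'$ extending $|(\bar x_n)_n|'=|x_n|^{p^n}$ (for any $n$ with $\bar x_n\ne 0$ and any lift $x_n\in\mathfrak{o}_K$ of $\bar x_n$). An isometric embedding $K\to L$ of such fields induces a homomorphism $K'\to L'$ by functoriality. Theorem. Let $K$ be a perfectoid analytic field. Then: 1. Every finite extension $L$ of $K$ is perfectoid. 2. For every finite extension $L$ of $K$, the field $L'$ is a finite extension of $K'$ via the map induced by $K\to L$, and the norm of $L'$ extends that of $K'$. The functor $L\mapsto L'$ is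 an equivalence from the category of finite extensions of $K$ to the category of finite extensions of $K'$ (with $K$-algebra, respectively $K'$-algebra, homomorphisms as morphisms). 3. In particular, the absolute Galois groups of $K$ and $K'$ are isomorphic as topological groups. -/

import Mathlib

open CategoryTheory
open scoped NNReal

universe u

/-! ### Analytic fields -/

/-- An analytic field: a field complete with respect to a multiplicative nonarchimedean norm
(multiplicativity is part of `NormedField`). -/
class IsAnalyticField (K : Type u) [NormedField K] : Prop
    extends IsUltrametricDist K, CompleteSpace K

namespace AnalyticField

/-- The valuation ring `𝔬_K = {x | ‖x‖ ≤ 1}` of an analytic field. -/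
noncomputable abbrev ringOfIntegers (K : Type u) [NormedField K] [IsAnalyticField K] : ValuationSubring K :=
  (NormedField.valuation (K := K)).valuationSubring

/-- `𝔬_K` is the ring of integers of the norm of `K`. -/
theorem integers (K : Type u) [NormedField K] [IsAnalyticField K] :
    (NormedField.valuation (K := K)).Integers (ringOfIntegers K) :=
  Valuation.integer.integers (NormedField.valuation (K := K))

theorem mem_ringOfIntegers {K : Type u} [NormedField K] [IsAnalyticField K] {x : K} :
    x ∈ ringOfIntegers K ↔ ‖x‖ ≤ 1 := by
  rw [Valuation.mem_valuationSubring_iff, NormedField.valuation_apply, ← NNReal.coe_le_coe]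
  simp

/-- A (trivially or nontrivially) discretely valued field: the group `‖Kˣ‖` is contained in an
infinite cyclic or trivial subgroup `rᶻ` of the positive reals. -/
def IsDiscretelyValued (K : Type u) [NormedField K] : Prop :=
  ∃ r : ℝ, 0 < r ∧ ∀ x : K, x ≠ 0 → ∃ n : ℤ, ‖x‖ = r ^ n

/-- Mixed characteristics: `‖p‖ = p⁻¹`, and the residue field has characteristic `p`. -/
class IsMixedChar (p : ℕ) (K : Type u) [NormedField K] [IsAnalyticField K] : Prop where
  norm_p : ‖(p : K)‖ = (p : ℝ)⁻¹
  residue_char : CharP (IsLocalRing.ResidueField (ringOfIntegers K)) p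

/-- If `‖p‖ = p⁻¹`, then the residue field automatically has characteristic `p`. -/
theorem IsMixedChar.of_norm (p : ℕ) [Fact p.Prime] (K : Type u) [NormedField K] [IsAnalyticField K]
    (hn : ‖(p : K)‖ = (p : ℝ)⁻¹) : IsMixedChar p K := by
  refine ⟨hn, ?_⟩
  have hp : (1 : ℝ) < p := by exact_mod_cast (Fact.out : p.Prime).one_lt
  refine (CharP.charP_iff_prime_eq_zero Fact.out).mpr ?_
  rw [← map_natCast (IsLocalRing.residue (ringOfIntegers K)), IsLocalRing.residue_eq_zero_iff,
    IsLocalRing.mem_maximalIdeal, mem_nonunits_iff]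
  intro h
  have h1 := (integers K).one_of_isUnit h
  rw [map_natCast, NormedField.valuation_apply] at h1
  have h2 : ‖(p : K)‖ = 1 := by rw [← coe_nnnorm, h1, NNReal.coe_one]
  exact (inv_lt_one_of_one_lt₀ hp).ne (hn.symm.trans h2)

/-- A perfectoid analytic field: mixed characteristics, not discretely valued, and the `p`-th power
map on `𝔬_K/(p)` is surjective. -/
class IsPerfectoid (p : ℕ) (K : Type u) [NormedField K] [IsAnalyticField K] : Prop
    extends IsMixedChar p K where
  not_discrete : ¬ IsDiscretelyValued K
  frobenius_surjective : Function.Surjective fun x : ModP (ringOfIntegers K) p => x ^ p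

/-! ### The perfect norm field -/

set_option linter.unusedSectionVars false

section PerfectNormField

variable (p : ℕ) [Fact p.Prime]

instance (K : Type u) [NormedField K] [IsAnalyticField K] [IsMixedChar p K] :
    Fact (NormedField.valuation (p : K) ≠ 1) := ⟨fun h => by
  have hp : (1 : ℝ) < p := by exact_mod_cast (Fact.out : p.Prime).one_lt
  have h1 : ‖(p : K)‖ = 1 := by
    rw [NormedField.valuation_apply] at h
    rw [← coe_nnnorm, h, NNReal.coe_one]
  rw [IsMixedChar.norm_p] at h1
  exact (inv_lt_one_of_one_lt₀ hp).ne h1⟩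

instance (K : Type u) [NormedField K] [IsAnalyticField K] [IsMixedChar p K] :
    Fact (¬ IsUnit (p : ringOfIntegers K)) := ⟨fun h => by
  have h1 := (integers K).one_of_isUnit h
  rw [map_natCast] at h1
  exact (Fact.out : NormedField.valuation (p : K) ≠ 1) h1⟩

/-- The ring `𝔬_{K'}`: the inverse limit of `𝔬_K/(p)` under Frobenius. -/
abbrev NormRing (K : Type u) [NormedField K] [IsAnalyticField K] [IsMixedChar p K] : Type u :=
  PreTilt (ringOfIntegers K) p

instance (K : Type u) [NormedField K] [IsAnalyticField K] [IsMixedChar p K] :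
    IsDomain (NormRing p K) :=
  PreTilt.isDomain K NormedField.valuation _ (integers K) p

/-- The perfect norm field (tilt) `K'` of `K`: the fraction field of `𝔬_{K'}`.
It is, by definition, `Tilt K NormedField.valuation (ringOfIntegers K) (integers K) p`. -/
abbrev PerfectNormField (K : Type u) [NormedField K] [IsAnalyticField K] [IsMixedChar p K] :
    Type u :=
  FractionRing (NormRing p K)

/-- The norm `|x|' = |x_n|^(p^n)` (for `n` with `x_n ≠ 0`) on `𝔬_{K'}`, extended to `K'`. -/
noncomputable def perfectNorm (K : Type u) [NormedField K] [IsAnalyticField K] [IsMixedChar p K] :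
    Valuation (PerfectNormField p K) ℝ≥0 :=
  (PreTilt.val K NormedField.valuation _ (integers K) p).extendToLocalization
    (S := nonZeroDivisors (NormRing p K))
    (fun _ hx h => nonZeroDivisors.ne_zero hx ((PreTilt.map_eq_zero (integers K)).mp h)) _

variable {K L M : Type u} [NormedField K] [IsAnalyticField K] [NormedField L] [IsAnalyticField L]
  [NormedField M] [IsAnalyticField M]

/-- The map `𝔬_K → 𝔬_L` induced by an isometric embedding `K → L`. -/
noncomputable def integersMap (f : K →+* L) (hf : ∀ x, ‖f x‖ = ‖x‖) : ringOfIntegers K →+* ringOfIntegers L where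
  toFun x := ⟨f x, mem_ringOfIntegers.mpr ((hf x).trans_le (mem_ringOfIntegers.mp x.2))⟩
  map_one' := Subtype.ext (map_one f)
  map_mul' _ _ := Subtype.ext (map_mul f _ _)
  map_zero' := Subtype.ext (map_zero f)
  map_add' _ _ := Subtype.ext (map_add f _ _)

/-- The induced map `𝔬_K/(p) → 𝔬_L/(p)`. -/
noncomputable def modPMap (f : K →+* L) (hf : ∀ x, ‖f x‖ = ‖x‖) :
    ModP (ringOfIntegers K) p →+* ModP (ringOfIntegers L) p :=
  Ideal.quotientMap _ (integersMap f hf) <| by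
    rw [Ideal.span_singleton_le_iff_mem, Ideal.mem_comap, map_natCast]
    exact Ideal.mem_span_singleton_self _

theorem modPMap_injective (f : K →+* L) (hf : ∀ x, ‖f x‖ = ‖x‖) :
    Function.Injective (modPMap p f hf) := by
  rw [injective_iff_map_eq_zero]
  intro a ha
  obtain ⟨x, rfl⟩ := Ideal.Quotient.mk_surjective a
  rw [modPMap, Ideal.quotientMap_mk, Ideal.Quotient.eq_zero_iff_mem,
    Ideal.mem_span_singleton, ← (integers L).le_iff_dvd] at ha
  rw [Ideal.Quotient.eq_zero_iff_mem, Ideal.mem_span_singleton, ← (integers K).le_iff_dvd]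
  have h1 : ‖f (x : K)‖ ≤ ‖((p : ringOfIntegers L) : L)‖ := ha
  change ‖(x : K)‖ ≤ ‖((p : ringOfIntegers K) : K)‖
  have h2 : ((p : ringOfIntegers L) : L) = f ((p : ringOfIntegers K) : K) := by simp
  rwa [h2, hf, hf] at h1

variable [IsMixedChar p K] [IsMixedChar p L] [IsMixedChar p M]

/-- The induced map `𝔬_{K'} → 𝔬_{L'}`, applying `𝔬_K/(p) → 𝔬_L/(p)` to each component. -/
noncomputable def normRingMap (f : K →+* L) (hf : ∀ x, ‖f x‖ = ‖x‖) : NormRing p K →+* NormRing p L :=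
  Perfection.map p (modPMap p f hf)

theorem coeff_normRingMap (f : K →+* L) (hf : ∀ x, ‖f x‖ = ‖x‖) (n : ℕ) (x : NormRing p K) :
    PreTilt.coeff n (normRingMap p f hf x) = modPMap p f hf (PreTilt.coeff n x) := rfl

theorem normRingMap_injective (f : K →+* L) (hf : ∀ x, ‖f x‖ = ‖x‖) :
    Function.Injective (normRingMap p f hf) := fun _ _ h =>
  Perfection.ext fun n => modPMap_injective p f hf (congrArg (PreTilt.coeff n) h)

theorem normRingMap_id (x : NormRing p K) : normRingMap p (RingHom.id K) (fun _ => rfl) x = x :=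
  Perfection.ext fun n => by
    obtain ⟨y, hy⟩ := Ideal.Quotient.mk_surjective (PreTilt.coeff n x)
    change modPMap p (RingHom.id K) _ (PreTilt.coeff n x) = PreTilt.coeff n x
    rw [← hy]
    rfl

theorem normRingMap_comp (f : K →+* L) (hf : ∀ x, ‖f x‖ = ‖x‖) (g : L →+* M)
    (hg : ∀ x, ‖g x‖ = ‖x‖) (h : K →+* M) (hh : ∀ x, ‖h x‖ = ‖x‖) (e : ∀ x, g (f x) = h x)
    (x : NormRing p K) : normRingMap p g hg (normRingMap p f hf x) = normRingMap p h hh x := by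
  obtain rfl : g.comp f = h := RingHom.ext e
  refine Perfection.ext fun n => ?_
  obtain ⟨y, hy⟩ := Ideal.Quotient.mk_surjective (PreTilt.coeff n x)
  change modPMap p g hg (modPMap p f hf (PreTilt.coeff n x)) =
    modPMap p (g.comp f) hh (PreTilt.coeff n x)
  rw [← hy]
  rfl

/-- The induced map `K' → L'`: functoriality of the perfect norm field. -/
noncomputable def perfectNormFieldMap (f : K →+* L) (hf : ∀ x, ‖f x‖ = ‖x‖) :
    PerfectNormField p K →+* PerfectNormField p L :=
  IsFractionRing.map (normRingMap_injective p f hf)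

theorem perfectNormFieldMap_algebraMap (f : K →+* L) (hf : ∀ x, ‖f x‖ = ‖x‖) (x : NormRing p K) :
    perfectNormFieldMap p f hf (algebraMap _ _ x) = algebraMap _ _ (normRingMap p f hf x) :=
  IsLocalization.map_eq (M := nonZeroDivisors (NormRing p K)) (T := nonZeroDivisors (NormRing p L))
    (nonZeroDivisors_le_comap_nonZeroDivisors_of_injective _ (normRingMap_injective p f hf)) x

theorem perfectNormFieldMap_id (x : PerfectNormField p K) :
    perfectNormFieldMap p (RingHom.id K) (fun _ => rfl) x = x := by
  have h : perfectNormFieldMap p (RingHom.id K) (fun _ => rfl) = RingHom.id _ :=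
    IsLocalization.ringHom_ext (nonZeroDivisors (NormRing p K)) <| RingHom.ext fun y => by
      simp [perfectNormFieldMap_algebraMap, normRingMap_id]
  rw [h, RingHom.id_apply]

theorem perfectNormFieldMap_comp (f : K →+* L) (hf : ∀ x, ‖f x‖ = ‖x‖) (g : L →+* M)
    (hg : ∀ x, ‖g x‖ = ‖x‖) (h : K →+* M) (hh : ∀ x, ‖h x‖ = ‖x‖) (e : ∀ x, g (f x) = h x)
    (x : PerfectNormField p K) :
    perfectNormFieldMap p g hg (perfectNormFieldMap p f hf x) = perfectNormFieldMap p h hh x := by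
  have h : (perfectNormFieldMap p g hg).comp (perfectNormFieldMap p f hf) =
      perfectNormFieldMap p h hh :=
    IsLocalization.ringHom_ext (nonZeroDivisors (NormRing p K)) <| RingHom.ext fun y => by
      simp [perfectNormFieldMap_algebraMap, normRingMap_comp p f hf g hg h hh e]
  rw [← h, RingHom.comp_apply]

end PerfectNormField

end AnalyticField

/-! ### The category of finite extensions of a field -/

/-- A finite extension of a field `k`. -/
structure FinExt (k : Type u) [Field k] where
  carrier : Type u
  [field : Field carrier]
  [algebra : Algebra k carrier]
  [finite : FiniteDimensional k carrier]

namespace FinExt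

instance (k : Type u) [Field k] : CoeSort (FinExt k) (Type u) := ⟨carrier⟩

attribute [instance] field algebra finite

/-- Morphisms of finite extensions of `k` are the `k`-algebra homomorphisms. -/
instance (k : Type u) [Field k] : Category (FinExt k) where
  Hom E F := E →ₐ[k] F
  id E := AlgHom.id k E
  comp f g := AlgHom.comp g f

section Analytic

variable {K : Type u} [NontriviallyNormedField K] [IsAnalyticField K]

/-- A finite extension `L` of an analytic field `K` carries the unique multiplicative norm extending
that of `K` (the spectral norm; for uniqueness see `NormedAlgebra.norm_eq_spectralNorm`). -/
noncomputable instance (L : FinExt K) : NormedField L := spectralNorm.normedField K L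

theorem norm_def (L : FinExt K) (x : L) : ‖x‖ = spectralNorm K L x := rfl

instance (L : FinExt K) : IsAnalyticField L where
  toIsUltrametricDist := IsUltrametricDist.isUltrametricDist_of_isNonarchimedean_norm
    (isNonarchimedean_spectralNorm (K := K) (L := L))
  toCompleteSpace := spectralNorm.completeSpace K L

theorem norm_algebraMap (L : FinExt K) (x : K) : ‖algebraMap K L x‖ = ‖x‖ :=
  spectralNorm_extends x

theorem norm_algHom {L M : FinExt K} (f : L →ₐ[K] M) (x : L) : ‖f x‖ = ‖x‖ := by
  rw [norm_def, norm_def, spectralNorm, spectralNorm,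
    minpoly.algHom_eq f (f : L →+* M).injective]

open AnalyticField

variable (p : ℕ) [Fact p.Prime] [IsMixedChar p K]

instance (L : FinExt K) : IsMixedChar p L := IsMixedChar.of_norm p L <| by
  have h := L.norm_algebraMap (p : K)
  rw [IsMixedChar.norm_p] at h
  rw [← h]
  exact congrArg norm (map_natCast (algebraMap K L) p).symm

/-- `L'` is an extension of `K'`, through the map induced by `K → L`. -/
noncomputable instance (L : FinExt K) : Algebra (PerfectNormField p K) (PerfectNormField p L) :=
  (perfectNormFieldMap p (algebraMap K L) L.norm_algebraMap).toAlgebra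

/-- A morphism `L → M` of finite extensions of `K` induces a morphism `L' → M'` over `K'`. -/
noncomputable def perfectNormFieldMap {L M : FinExt K} (f : L →ₐ[K] M) :
    PerfectNormField p L →ₐ[PerfectNormField p K] PerfectNormField p M where
  __ := AnalyticField.perfectNormFieldMap p (f : L →+* M) (norm_algHom f)
  commutes' x := perfectNormFieldMap_comp p (algebraMap K L) L.norm_algebraMap (f : L →+* M)
    (norm_algHom f) (algebraMap K M) M.norm_algebraMap f.commutes x

/-- The functor `L ↦ L'` from finite extensions of `K` to finite extensions of `K'`, given that
each `L'` is finite over `K'`. -/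
noncomputable def perfectNormFunctor
    (h : ∀ L : FinExt K, FiniteDimensional (PerfectNormField p K) (PerfectNormField p L)) :
    FinExt K ⥤ FinExt (PerfectNormField p K) where
  obj L := { carrier := PerfectNormField p L, finite := h L }
  map f := perfectNormFieldMap p f
  map_id _ := AlgHom.ext fun x => AnalyticField.perfectNormFieldMap_id p x
  map_comp f g := AlgHom.ext fun x =>
    (perfectNormFieldMap_comp p (f : _ →ₐ[K] _).toRingHom (norm_algHom f)
      (g : _ →ₐ[K] _).toRingHom (norm_algHom g) _ (norm_algHom (AlgHom.comp g f))
      (fun _ => rfl) x).symm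

end Analytic

end FinExt

/-!
The proof goes through the completed algebraic closure `C` of `K` (`CAlgCl K`). It is an
algebraically closed perfectoid field, so its tilt `C'` (`TiltC K p`) is algebraically closed
(`tilt_isAlgClosed`), and finite extensions of `K'` may be taken to be subfields of `C'`. Elements
of the tilt are compared with elements of `C` through the multiplicative map `y ↦ y♯` (`sharp`).

A finite extension `E` of `K'` in `C'` is untilted by Fontaine's map: the image of the Witt vectors
of `𝔬_E` in `𝔬_C`, with `p` inverted, is a `K`-algebra `thetaSubalgebra E`. The key point is that it
is finite over `K`. Since `E` is finite over the complete perfect field `K'`, there are finitely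
many `bᵢ ∈ 𝔬_E` and a nonzero `c ∈ 𝔬_{K'}` such that `c 𝔬_E` lies in the span of the `bᵢ`;
extracting `p`-power roots brings `|c|` arbitrarily close to `1` (`exists_almost_coordinates`). As
soon as `|p| < |c|`, successive approximation shows that the `bᵢ♯` span `thetaSubalgebra E` over `K`
(`thetaRange_le_span`). It is therefore a finite extension `untilt E` of `K` inside the algebraic
closure, and modulo `p` its integers are sharps of elements of `E`.

The untilts exhaust the algebraic closure of `K` (`untiltUnion_eq_top`): lifting the minimal
polynomial of `a` modulo `p` to the tilt and taking a root there yields approximations of `a` by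
elements of the union of the untilts, the distance shrinking by a fixed factor at each step; so `a`
is a limit of such elements, hence is fixed by all automorphisms over the union.

An automorphism of the algebraic closure of `K` fixes `untilt E` if and only if its action on `C'`
fixes `E`, as `untilt E` consists of `p`-adic combinations of sharps of `E`
(`apply_eq_of_mem_untilt`), and conversely `y` is determined by the sharps of its `p`-power roots
(`actTilt_eq_of_forall_untilt`). Hence restriction to the algebraic closure of `K'` in `C'` is an
isomorphism of topological groups from the Galois group of `K` to that of `K'` (`galTiltEquiv`):
it is injective by exhaustion, and surjective because its image is closed with fixed field `K'`.

By infinite Galois theory every finite extension of `K` inside its algebraic closure is `untilt E`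
for some `E` (`exists_untilt_lift_eq`). Its tilt is `E` (`FinExt.fieldRange_toTiltC`), where one
inclusion uses that `E` is closed in `C'`. This gives the finiteness of `L'`, the fact that `L` is
perfectoid, and essential surjectivity. Faithfulness holds because morphisms are determined on
sharps (`ringHom_eq_of_perfectNormFieldMap_eq`); for fullness, a morphism `L' → M'` is realized by
an automorphism of the algebraic closure of `K`, and `untilt` is monotone.
-/

set_option linter.unusedSectionVars false

namespace AnalyticField

/-! ### The ring of integers of an analytic field -/

section Integers

variable {F : Type u} [NormedField F] [IsAnalyticField F]

theorem norm_coe_le_one (x : ringOfIntegers F) : ‖(x : F)‖ ≤ 1 :=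
  mem_ringOfIntegers.mp x.2

theorem dvd_iff_norm_le {x y : ringOfIntegers F} : y ∣ x ↔ ‖(x : F)‖ ≤ ‖(y : F)‖ :=
  (integers F).le_iff_dvd.symm

variable (p : ℕ) [Fact p.Prime] [IsMixedChar p F]

theorem norm_p_pos : 0 < ‖(p : F)‖ := by
  rw [IsMixedChar.norm_p]
  exact inv_pos.mpr (by exact_mod_cast (Fact.out : p.Prime).pos)

theorem norm_p_lt_one : ‖(p : F)‖ < 1 := by
  rw [IsMixedChar.norm_p]
  exact inv_lt_one_of_one_lt₀ (by exact_mod_cast (Fact.out : p.Prime).one_lt)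

theorem p_ne_zero : (p : F) ≠ 0 := norm_pos_iff.mp (norm_p_pos p)

theorem p_pow_dvd_iff {n : ℕ} {x : ringOfIntegers F} :
    (p : ringOfIntegers F) ^ n ∣ x ↔ ‖(x : F)‖ ≤ ‖(p : F)‖ ^ n := by
  rw [dvd_iff_norm_le]
  simp

theorem p_dvd_iff {x : ringOfIntegers F} :
    (p : ringOfIntegers F) ∣ x ↔ ‖(x : F)‖ ≤ ‖(p : F)‖ := by
  simpa using p_pow_dvd_iff p (n := 1) (x := x)

theorem mk_eq_mk_iff {x y : ringOfIntegers F} :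
    Ideal.Quotient.mk (Ideal.span {(p : ringOfIntegers F)}) x = Ideal.Quotient.mk _ y ↔
      ‖(x : F) - y‖ ≤ ‖(p : F)‖ := by
  rw [Ideal.Quotient.eq, Ideal.mem_span_singleton, p_dvd_iff]
  rfl

theorem eq_zero_of_forall_norm_le {E : Type*} [NormedAddCommGroup E] {x : E} {r : ℝ} (hr0 : 0 ≤ r)
    (hr : r < 1) {c : ℝ} (h : ∀ n : ℕ, ‖x‖ ≤ r ^ n * c) : x = 0 := by
  have h1 : Filter.Tendsto (fun n : ℕ => r ^ n * c) Filter.atTop (nhds (0 * c)) :=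
    (tendsto_pow_atTop_nhds_zero_of_lt_one hr0 hr).mul_const c
  rw [zero_mul] at h1
  exact norm_le_zero_iff.mp (ge_of_tendsto' h1 h)

/-- The norm topology and the `p`-adic topology on the ring of integers coincide, so completeness
of the field is `p`-adic completeness of its ring of integers. -/
instance isAdicComplete :
    IsAdicComplete (Ideal.span {(p : ringOfIntegers F)}) (ringOfIntegers F) where
  haus' x hx := by
    refine Subtype.ext (eq_zero_of_forall_norm_le (norm_nonneg (p : F)) (norm_p_lt_one p)
      (c := 1) fun n => ?_)
    have := hx n
    rw [SModEq.zero, smul_eq_mul, Ideal.mul_top, Ideal.span_singleton_pow,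
      Ideal.mem_span_singleton, p_pow_dvd_iff] at this
    simpa using this
  prec' f hf := by
    have hf' : ∀ {m n : ℕ}, m ≤ n → ‖(f m : F) - f n‖ ≤ ‖(p : F)‖ ^ m := fun {m n} h => by
      have := hf h
      rw [SModEq.sub_mem, smul_eq_mul, Ideal.mul_top, Ideal.span_singleton_pow,
        Ideal.mem_span_singleton, p_pow_dvd_iff] at this
      exact this
    have hc : CauchySeq fun n => (f n : F) := by
      refine cauchySeq_of_le_geometric ‖(p : F)‖ 1 (norm_p_lt_one p) fun n => ?_
      rw [dist_eq_norm, one_mul]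
      exact hf' n.le_succ
    obtain ⟨L, hL⟩ := cauchySeq_tendsto_of_complete hc
    have hL1 : ‖L‖ ≤ 1 := le_of_tendsto' hL.norm fun n => norm_coe_le_one (f n)
    refine ⟨⟨L, mem_ringOfIntegers.mpr hL1⟩, fun n => ?_⟩
    rw [SModEq.sub_mem, smul_eq_mul, Ideal.mul_top, Ideal.span_singleton_pow,
      Ideal.mem_span_singleton, p_pow_dvd_iff]
    refine le_of_tendsto ((tendsto_const_nhds (x := (f n : F))).sub hL).norm ?_
    filter_upwards [Filter.eventually_ge_atTop n] with m hm using hf' hm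

end Integers

/-! ### The sharp map and the norm of the tilt -/

section Sharp

variable (p : ℕ) [Fact p.Prime] {F : Type u} [NormedField F] [IsAnalyticField F] [IsMixedChar p F]

variable (F) in
/-- The multiplicative map `x ↦ x♯ = lim xₙ ^ (p ^ n)` from `𝔬_{F'}` to `F`. -/
noncomputable def sharp : NormRing p F →* F :=
  (ringOfIntegers F).subtype.toMonoidHom.comp PreTilt.untilt

theorem coe_untilt (y : NormRing p F) :
    ((PreTilt.untilt y : ringOfIntegers F) : F) = sharp p F y := rfl

theorem norm_sharp_le_one (y : NormRing p F) : ‖sharp p F y‖ ≤ 1 := norm_coe_le_one _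

/-- The `p ^ n`-th root in the perfect ring `𝔬_{F'}`. -/
noncomputable def root (n : ℕ) (y : NormRing p F) : NormRing p F :=
  (frobeniusEquiv (NormRing p F) p).symm^[n] y

variable {p}

theorem root_pow (n : ℕ) (y : NormRing p F) : root p n y ^ p ^ n = y := by
  rw [root, ← iterate_frobenius]
  exact (Function.RightInverse.iterate (frobenius_apply_frobeniusEquiv_symm _ p) n) y

theorem coeff_root (m n : ℕ) (y : NormRing p F) :
    PreTilt.coeff m (root p n y) = PreTilt.coeff (m + n) y :=
  PreTilt.coeff_iterate_frobeniusEquiv_symm m n y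

theorem root_succ_pow (n : ℕ) (y : NormRing p F) : root p (n + 1) y ^ p = root p n y := by
  rw [root, Function.iterate_succ_apply', frobeniusEquiv_symm_pow_p]
  rfl

theorem sharp_root_pow (n : ℕ) (y : NormRing p F) :
    sharp p F (root p n y) ^ p ^ n = sharp p F y := by
  rw [← map_pow, root_pow]

theorem coeff_eq_mk_untilt_root (n : ℕ) (y : NormRing p F) :
    PreTilt.coeff n y = Ideal.Quotient.mk _ (PreTilt.untilt (root p n y)) := by
  rw [PreTilt.mk_untilt_eq_coeff_zero, coeff_root, zero_add]

theorem coeff_zero_eq_mk_untilt (y : NormRing p F) :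
    PreTilt.coeff 0 y = Ideal.Quotient.mk _ (PreTilt.untilt y) :=
  (PreTilt.mk_untilt_eq_coeff_zero y).symm

theorem normRing_ext {x y : NormRing p F} (h : ∀ n, PreTilt.coeff n x = PreTilt.coeff n y) :
    x = y :=
  Perfection.ext h

theorem root_pow_pow (n : ℕ) (y : NormRing p F) : root p n (y ^ p ^ n) = y := by
  rw [root, ← iterate_frobenius]
  exact (Function.LeftInverse.iterate (frobeniusEquiv_symm_apply_frobenius _ p) n) y

@[simp]
theorem sharp_zero : sharp p F 0 = 0 := by
  have h0 : sharp p F 0 * sharp p F 0 = sharp p F 0 := by rw [← map_mul, mul_zero]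
  have h1 : ‖sharp p F 0‖ ≤ ‖(p : F)‖ := by
    rw [← coe_untilt, ← p_dvd_iff, ← Ideal.mem_span_singleton, ← Ideal.Quotient.eq_zero_iff_mem,
      ← coeff_zero_eq_mk_untilt, map_zero]
  by_contra h
  rw [mul_eq_left₀ h] at h0
  rw [h0, norm_one] at h1
  exact absurd (norm_p_lt_one (F := F) p) h1.not_gt

theorem coeff_eq_zero_iff_norm_sharp_root {n : ℕ} {y : NormRing p F} :
    PreTilt.coeff n y = 0 ↔ ‖sharp p F (root p n y)‖ ≤ ‖(p : F)‖ := by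
  rw [coeff_eq_mk_untilt_root, Ideal.Quotient.eq_zero_iff_mem, Ideal.mem_span_singleton, p_dvd_iff,
    coe_untilt]

theorem coeff_eq_zero_iff_norm_sharp {n : ℕ} {y : NormRing p F} :
    PreTilt.coeff n y = 0 ↔ ‖sharp p F y‖ ≤ ‖(p : F)‖ ^ p ^ n := by
  rw [coeff_eq_zero_iff_norm_sharp_root, ← sharp_root_pow n y, norm_pow]
  exact (pow_le_pow_iff_left₀ (norm_nonneg _) (norm_nonneg _)
    (pow_ne_zero _ (Fact.out : p.Prime).ne_zero)).symm

theorem tendsto_norm_p_pow_pow :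
    Filter.Tendsto (fun n : ℕ => ‖(p : F)‖ ^ p ^ n) Filter.atTop (nhds 0) :=
  (tendsto_pow_atTop_nhds_zero_of_lt_one (norm_nonneg _) (norm_p_lt_one p)).comp
    (tendsto_pow_atTop_atTop_of_one_lt (Fact.out : p.Prime).one_lt)

@[simp]
theorem sharp_eq_zero {y : NormRing p F} : sharp p F y = 0 ↔ y = 0 := by
  refine ⟨fun h => normRing_ext fun n => ?_, fun h => h ▸ sharp_zero⟩
  rw [map_zero, coeff_eq_zero_iff_norm_sharp, h, norm_zero]
  positivity

theorem exists_coeff_ne_zero {y : NormRing p F} (hy : y ≠ 0) : ∃ n, PreTilt.coeff n y ≠ 0 := by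
  by_contra! h
  exact hy (normRing_ext fun n => by rw [h, map_zero])

/-- `|y|' = |y♯|`. -/
theorem val_eq_nnnorm_sharp (y : NormRing p F) :
    PreTilt.val F NormedField.valuation _ (integers F) p y = ‖sharp p F y‖₊ := by
  rcases eq_or_ne y 0 with rfl | hy
  · simp
  obtain ⟨n, hn⟩ := exists_coeff_ne_zero hy
  change PreTilt.valAux F _ _ p y = _
  rw [PreTilt.valAux_eq (integers F) hn]
  rw [coeff_eq_mk_untilt_root] at hn ⊢
  rw [ModP.preVal_mk (integers F) hn, ← sharp_root_pow n y, nnnorm_pow]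
  rfl

/-- The element of `𝔬_{F'}` given by a compatible system of `p`-power roots in `𝔬_F`. -/
noncomputable def ofRoots (c : ℕ → ringOfIntegers F) (h : ∀ n, c (n + 1) ^ p = c n) :
    NormRing p F :=
  ⟨fun n => Ideal.Quotient.mk _ (c n), fun n => by rw [← map_pow, h]⟩

theorem coeff_ofRoots (c : ℕ → ringOfIntegers F) (h : ∀ n, c (n + 1) ^ p = c n) (n : ℕ) :
    PreTilt.coeff n (ofRoots c h) = Ideal.Quotient.mk _ (c n) := rfl

/-- `𝔬_{F'}` is a valuation ring. -/
theorem dvd_of_norm_sharp_le {x y : NormRing p F} (h : ‖sharp p F x‖ ≤ ‖sharp p F y‖) :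
    y ∣ x := by
  rcases eq_or_ne y 0 with rfl | hy
  · rw [sharp_zero, norm_zero, norm_le_zero_iff, sharp_eq_zero] at h
    rw [h]
  have hy' : ∀ n, sharp p F (root p n y) ≠ 0 := fun n h0 => hy <| by
    rw [← root_pow n y, sharp_eq_zero.mp h0, zero_pow]
    exact pow_ne_zero _ (Fact.out : p.Prime).ne_zero
  have hc : ∀ n, sharp p F (root p n x) / sharp p F (root p n y) ∈ ringOfIntegers F := fun n => by
    rw [mem_ringOfIntegers, norm_div, div_le_one (norm_pos_iff.mpr (hy' n))]
    refine (pow_le_pow_iff_left₀ (norm_nonneg _) (norm_nonneg _)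
      (pow_ne_zero n (Fact.out : p.Prime).ne_zero)).mp ?_
    rwa [← norm_pow, ← norm_pow, sharp_root_pow, sharp_root_pow]
  refine ⟨ofRoots (fun n => ⟨_, hc n⟩) fun n => Subtype.ext ?_, normRing_ext fun n => ?_⟩
  · change (_ / _) ^ p = _ / _
    rw [div_pow, ← map_pow, ← map_pow, root_succ_pow, root_succ_pow]
  · rw [map_mul, coeff_ofRoots, coeff_eq_mk_untilt_root, coeff_eq_mk_untilt_root, ← map_mul]
    refine congrArg _ (Subtype.ext ?_)
    change sharp p F _ = sharp p F _ * (sharp p F _ / _)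
    rw [mul_div_cancel₀ _ (hy' n)]

/-- The sharp of an element of `𝔬_{F'}` is determined by its sequence of coefficients. -/
theorem sharp_eq_of_forall {y : NormRing p F} {a : F} (c : ℕ → ringOfIntegers F)
    (h1 : ∀ n, (c n : F) ^ p ^ n = a) (h2 : ∀ n, PreTilt.coeff n y = Ideal.Quotient.mk _ (c n)) :
    sharp p F y = a := by
  rw [← sub_eq_zero]
  refine eq_zero_of_forall_norm_le (norm_nonneg (p : F)) (norm_p_lt_one p) (c := 1) fun n => ?_
  have h3 := h2 n
  rw [coeff_eq_mk_untilt_root, Ideal.Quotient.eq, Ideal.mem_span_singleton] at h3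
  have h4 := dvd_sub_pow_of_dvd_sub h3 n
  rw [p_pow_dvd_iff] at h4
  rw [mul_one, ← h1 n, ← sharp_root_pow n y]
  exact h4.trans (pow_le_pow_of_le_one (norm_nonneg _) (norm_p_lt_one p).le n.le_succ)

end Sharp

/-! ### Functoriality of the sharp map -/

section Functoriality

variable {p : ℕ} [Fact p.Prime] {F E : Type u} [NormedField F] [IsAnalyticField F]
  [NormedField E] [IsAnalyticField E] [IsMixedChar p F] [IsMixedChar p E]

theorem modPMap_mk (f : F →+* E) (hf : ∀ x, ‖f x‖ = ‖x‖) (x : ringOfIntegers F) :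
    modPMap p f hf (Ideal.Quotient.mk _ x) = Ideal.Quotient.mk _ (integersMap f hf x) := rfl

theorem root_normRingMap (f : F →+* E) (hf : ∀ x, ‖f x‖ = ‖x‖) (n : ℕ) (y : NormRing p F) :
    root p n (normRingMap p f hf y) = normRingMap p f hf (root p n y) :=
  normRing_ext fun m => by
    rw [coeff_root, coeff_normRingMap, coeff_normRingMap, coeff_root]

theorem sharp_normRingMap (f : F →+* E) (hf : ∀ x, ‖f x‖ = ‖x‖) (y : NormRing p F) :
    sharp p E (normRingMap p f hf y) = f (sharp p F y) := by
  refine sharp_eq_of_forall (fun n => integersMap f hf (PreTilt.untilt (root p n y)))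
    (fun n => ?_) fun n => ?_
  · rw [← sharp_root_pow n y, map_pow]
    rfl
  · rw [coeff_normRingMap, coeff_eq_mk_untilt_root, modPMap_mk]

/-- An element of `𝔬_{E'}` all of whose `p`-power roots have their sharps in `F` comes
from `𝔬_{F'}`. -/
theorem exists_normRingMap_eq (f : F →+* E) (hf : ∀ x, ‖f x‖ = ‖x‖) (y : NormRing p E)
    (h : ∀ n, ∃ x : F, f x = sharp p E (root p n y)) : ∃ z, normRingMap p f hf z = y := by
  choose c hc using h
  have hc' : ∀ n, c n ∈ ringOfIntegers F := fun n => by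
    rw [mem_ringOfIntegers, ← hf, hc]
    exact norm_sharp_le_one _ _
  refine ⟨ofRoots (fun n => ⟨c n, hc' n⟩) fun n => Subtype.ext (f.injective ?_),
    normRing_ext fun n => ?_⟩
  · change f (c (n + 1) ^ p) = f (c n)
    rw [map_pow, hc, hc, ← map_pow, root_succ_pow]
  · rw [coeff_normRingMap, coeff_ofRoots, modPMap_mk, coeff_eq_mk_untilt_root]
    exact congrArg _ (Subtype.ext (hc n))

end Functoriality

/-! ### The perfect norm field as a normed field -/

section TiltField

variable {p : ℕ} [Fact p.Prime] {F : Type u} [NormedField F] [IsAnalyticField F] [IsMixedChar p F]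

theorem perfectNorm_algebraMap (y : NormRing p F) :
    perfectNorm p F (algebraMap _ _ y) = ‖sharp p F y‖₊ := by
  rw [← val_eq_nnnorm_sharp]
  exact Valuation.extendToLocalization_apply_map_apply _ _ _ _

theorem algebraMap_normRing_injective :
    Function.Injective (algebraMap (NormRing p F) (PerfectNormField p F)) :=
  IsFractionRing.injective _ _

theorem perfectNorm_le_one_iff {d : PerfectNormField p F} :
    perfectNorm p F d ≤ 1 ↔ ∃ y : NormRing p F, algebraMap _ _ y = d := by
  constructor
  · intro h
    obtain ⟨a, b, hb, rfl⟩ := IsFractionRing.div_surjective (A := NormRing p F) d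
    have hb0 : b ≠ 0 := nonZeroDivisors.ne_zero hb
    rw [map_div₀, perfectNorm_algebraMap, perfectNorm_algebraMap,
      div_le_one₀ (nnnorm_pos.mpr (mt sharp_eq_zero.mp hb0))] at h
    obtain ⟨c, rfl⟩ := dvd_of_norm_sharp_le (p := p) (x := a) (y := b) h
    refine ⟨c, ?_⟩
    rw [map_mul, mul_div_cancel_left₀]
    exact fun h0 => hb0 (algebraMap_normRing_injective (h0.trans (map_zero _).symm))
  · rintro ⟨y, rfl⟩
    rw [perfectNorm_algebraMap]
    exact norm_sharp_le_one p y

theorem perfectNorm_map {E : Type u} [NormedField E] [IsAnalyticField E] [IsMixedChar p E]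
    (f : F →+* E) (hf : ∀ x, ‖f x‖ = ‖x‖) (d : PerfectNormField p F) :
    perfectNorm p E (perfectNormFieldMap p f hf d) = perfectNorm p F d := by
  obtain ⟨a, b, hb, rfl⟩ := IsFractionRing.div_surjective (A := NormRing p F) d
  simp only [map_div₀, perfectNormFieldMap_algebraMap, perfectNorm_algebraMap, sharp_normRingMap]
  congr 1 <;> exact NNReal.eq (hf _)

variable (p F) in
/-- The norm of the perfect norm field, as an absolute value. -/
noncomputable def tiltAbs : AbsoluteValue (PerfectNormField p F) ℝ where
  toFun d := perfectNorm p F d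
  map_mul' x y := by simp
  nonneg' x := NNReal.coe_nonneg _
  eq_zero' x := by simp
  add_le' x y := by
    have h := (perfectNorm p F).map_add x y
    exact_mod_cast h.trans (max_le (le_add_of_nonneg_right zero_le) (le_add_of_nonneg_left zero_le))

variable (p F) in
/-- The perfect norm field with its norm, as a normed field. -/
@[reducible]
noncomputable def tiltNormedField : NormedField (PerfectNormField p F) :=
  (tiltAbs p F).toNormedField

instance : CharP (PerfectNormField p F) p :=
  IsFractionRing.charP (NormRing p F) p

section

attribute [local instance] tiltNormedField

theorem tilt_norm_def (d : PerfectNormField p F) : ‖d‖ = perfectNorm p F d := rfl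

theorem norm_algebraMap_normRing (y : NormRing p F) :
    ‖algebraMap (NormRing p F) (PerfectNormField p F) y‖ = ‖sharp p F y‖ := by
  rw [tilt_norm_def, perfectNorm_algebraMap, coe_nnnorm]

theorem tilt_norm_le_one_iff {d : PerfectNormField p F} :
    ‖d‖ ≤ 1 ↔ ∃ y : NormRing p F, algebraMap _ _ y = d := by
  rw [← perfectNorm_le_one_iff, tilt_norm_def, ← NNReal.coe_one, NNReal.coe_le_coe]

theorem tilt_isUltrametricDist : IsUltrametricDist (PerfectNormField p F) :=
  IsUltrametricDist.isUltrametricDist_of_forall_norm_add_le_max_norm fun x y => by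
    have h := (perfectNorm p F).map_add x y
    rw [tilt_norm_def, tilt_norm_def, tilt_norm_def, ← NNReal.coe_max, NNReal.coe_le_coe]
    exact h

/-- The perfect norm field is complete: in a Cauchy sequence of `𝔬_{F'}`, every coefficient is
eventually constant. -/
theorem tilt_completeSpace : CompleteSpace (PerfectNormField p F) := by
  refine Metric.complete_of_cauchySeq_tendsto fun u hu => ?_
  obtain ⟨N, hN⟩ := Metric.cauchySeq_iff'.mp hu 1 one_pos
  have hv : ∀ n, ∃ v : NormRing p F,
      algebraMap _ (PerfectNormField p F) v = u (n + N) - u N := fun n => by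
    rw [← tilt_norm_le_one_iff, ← dist_eq_norm]
    exact (hN _ (Nat.le_add_left _ _)).le
  choose v hv using hv
  have h1 : ∀ m, ∃ M, ∀ i ≥ M, ∀ j ≥ M, PreTilt.coeff m (v i) = PreTilt.coeff m (v j) := fun m => by
    obtain ⟨M, hM⟩ := Metric.cauchySeq_iff.mp hu (‖(p : F)‖ ^ p ^ m) (pow_pos (norm_p_pos p) _)
    refine ⟨M, fun i hi j hj => ?_⟩
    rw [← sub_eq_zero, ← map_sub, coeff_eq_zero_iff_norm_sharp, ← norm_algebraMap_normRing,
      map_sub, hv, hv, sub_sub_sub_cancel_right, ← dist_eq_norm]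
    exact (hM _ (by omega) _ (by omega)).le
  choose M hM using h1
  let L : NormRing p F := ⟨fun m => PreTilt.coeff m (v (M m)), fun m => by
    have e1 := hM (m + 1) _ (le_refl _) _ (le_max_left (M (m + 1)) (M m))
    have e2 := hM m _ (le_refl _) _ (le_max_right (M (m + 1)) (M m))
    change PreTilt.coeff (m + 1) (v (M (m + 1))) ^ p = PreTilt.coeff m (v (M m))
    rw [e1, e2, PreTilt.coeff_pow_p]⟩
  have hL : ∀ m, PreTilt.coeff m L = PreTilt.coeff m (v (M m)) := fun m => rfl
  refine ⟨algebraMap _ _ L + u N, Metric.tendsto_atTop.mpr fun ε hε => ?_⟩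
  obtain ⟨m, hm⟩ := (((tendsto_norm_p_pow_pow (p := p) (F := F)).eventually_lt_const hε)).exists
  refine ⟨M m + N, fun n hn => lt_of_le_of_lt ?_ hm⟩
  obtain ⟨k, rfl⟩ : ∃ k, n = k + N := ⟨n - N, by omega⟩
  rw [dist_eq_norm, sub_add_eq_sub_sub_swap, ← hv, ← map_sub, norm_algebraMap_normRing,
    ← coeff_eq_zero_iff_norm_sharp, map_sub, hL, sub_eq_zero]
  exact hM m _ (by omega) _ le_rfl

end

instance tilt_perfectRing : PerfectRing (PerfectNormField p F) p :=
  PerfectRing.ofSurjective _ _ fun d => by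
    obtain ⟨a, b, hb, rfl⟩ := IsFractionRing.div_surjective (A := NormRing p F) d
    refine ⟨algebraMap _ _ (root p 1 a) / algebraMap _ _ (root p 1 b), ?_⟩
    have h : ∀ y : NormRing p F, root p 1 y ^ p = y := fun y => by simpa using root_pow 1 y
    rw [frobenius_def, div_pow, ← map_pow, ← map_pow, h, h]

instance : PerfectField (PerfectNormField p F) :=
  PerfectRing.toPerfectField _ p

end TiltField

end AnalyticField

/-! ### A criterion for algebraic closedness -/

section Generic

open Polynomial

/-- A complete nonarchimedean field over which monic integral polynomials take arbitrarily small
values is algebraically closed: the value at `z` is the product of the distances from `z` to the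
roots, so some root is a limit of elements of the field. -/
theorem isAlgClosed_of_forall_exists_norm_eval_lt {D : Type*} [NontriviallyNormedField D]
    [CompleteSpace D] [IsUltrametricDist D]
    (h : ∀ f : D[X], f.Monic → f.natDegree ≠ 0 → (∀ i, ‖f.coeff i‖ ≤ 1) →
      ∀ ε > 0, ∃ z, ‖f.eval z‖ < ε) : IsAlgClosed D := by
  refine IsAlgClosed.of_exists_root _ fun f hf hirr => ?_
  have hd : f.natDegree ≠ 0 := hirr.natDegree_pos.ne'
  -- Scaling the roots makes the coefficients integral.
  obtain ⟨c, hc0, hc1, hc⟩ : ∃ c : D, c ≠ 0 ∧ ‖c‖ ≤ 1 ∧ ∀ i, ‖f.coeff i‖ * ‖c‖ ≤ 1 := by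
    obtain ⟨B, hB0, hB⟩ : ∃ B : ℝ, 1 ≤ B ∧ ∀ i, ‖f.coeff i‖ ≤ B := by
      refine ⟨1 + ∑ i ∈ f.support, ‖f.coeff i‖,
        le_add_of_nonneg_right (Finset.sum_nonneg fun _ _ => norm_nonneg _), fun i => ?_⟩
      by_cases hi : i ∈ f.support
      · exact (Finset.single_le_sum (f := fun i => ‖f.coeff i‖) (fun _ _ => norm_nonneg _) hi).trans
          (le_add_of_nonneg_left zero_le_one)
      · rw [notMem_support_iff.mp hi, norm_zero]
        exact add_nonneg zero_le_one (Finset.sum_nonneg fun _ _ => norm_nonneg _)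
    obtain ⟨c, hc0, hc⟩ := NormedField.exists_norm_lt D (inv_pos.mpr (zero_lt_one.trans_le hB0))
    have hc1 : B * ‖c‖ ≤ 1 := by
      rw [mul_comm, ← le_div_iff₀ (zero_lt_one.trans_le hB0), one_div]
      exact hc.le
    exact ⟨c, norm_pos_iff.mp hc0, hc.le.trans (inv_le_one_of_one_le₀ hB0),
      fun i => (mul_le_mul_of_nonneg_right (hB i) (norm_nonneg _)).trans hc1⟩
  set g := scaleRoots f c with hg
  have hgm : g.Monic := (monic_scaleRoots_iff c).mpr hf
  have hgd : g.natDegree = f.natDegree := natDegree_scaleRoots f c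
  have hgc : ∀ i, ‖g.coeff i‖ ≤ 1 := fun i => by
    rw [hg, coeff_scaleRoots, norm_mul, norm_pow]
    rcases lt_trichotomy i f.natDegree with hi | hi | hi
    · obtain ⟨k, hk⟩ : ∃ k, f.natDegree - i = k + 1 := ⟨f.natDegree - i - 1, by omega⟩
      rw [hk, pow_succ', ← mul_assoc]
      exact mul_le_one₀ (hc i) (by positivity) (pow_le_one₀ (norm_nonneg _) hc1)
    · simp [hi, hf.coeff_natDegree]
    · simp [coeff_eq_zero_of_natDegree_lt hi]
  suffices ∃ r, g.eval r = 0 by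
    obtain ⟨r, hr⟩ := this
    refine ⟨r / c, ?_⟩
    have := scaleRoots_eval₂_mul (p := f) (RingHom.id D) (r / c) c
    rw [RingHom.id_apply, mul_div_cancel₀ _ hc0, ← hg, eval₂_id, eval₂_id, hr] at this
    exact (mul_eq_zero.mp this.symm).resolve_left (pow_ne_zero _ hc0)
  let E := g.SplittingField
  let : NormedField E := spectralNorm.normedField D E
  let : NormedAlgebra D E := spectralNorm.normedAlgebra D E
  have hs : (g.map (algebraMap D E)).Splits := SplittingField.splits g
  have heval : ∀ z : D, ‖g.eval z‖ =
      ((g.map (algebraMap D E)).roots.map fun b => ‖algebraMap D E z - b‖).prod := fun z => by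
    rw [← norm_algebraMap' E (g.eval z), ← eval₂_at_apply, ← Polynomial.eval_map,
      hs.eval_eq_prod_roots_of_monic (hgm.map _)]
    rw [← coe_nnnorm, ← nnnormHom_apply, map_multiset_prod, Multiset.map_map,
      ← NNReal.coe_toRealHom, map_multiset_prod, Multiset.map_map]
    rfl
  obtain ⟨b, hb, hb'⟩ : ∃ b ∈ (g.map (algebraMap D E)).roots, ∀ ε > 0, ∃ z : D,
      ‖algebraMap D E z - b‖ < ε := by
    by_contra! H
    choose! ε hε H using H
    obtain ⟨z, hz⟩ := h g hgm (hgd ▸ hd) hgc _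
      (Multiset.prod_pos (s := (g.map (algebraMap D E)).roots.map ε) fun a ha => by
        obtain ⟨b, hb, rfl⟩ := Multiset.mem_map.mp ha
        exact hε b hb)
    rw [heval] at hz
    exact absurd hz (not_lt.mpr
      (Multiset.prod_map_le_prod_map₀ _ _ (fun b hb => (hε b hb).le) fun b hb => H b hb z))
  have hcl : IsClosed (Set.range (algebraMap D E)) :=
    (AddMonoidHomClass.isometry_of_norm (algebraMap D E)
      (norm_algebraMap' E)).isClosedEmbedding.isClosed_range
  obtain ⟨r, rfl⟩ : b ∈ Set.range (algebraMap D E) := by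
    rw [← hcl.closure_eq, Metric.mem_closure_range_iff]
    intro ε hε
    obtain ⟨z, hz⟩ := hb' ε hε
    exact ⟨z, by rwa [dist_comm, dist_eq_norm]⟩
  refine ⟨r, (algebraMap D E).injective ?_⟩
  rw [map_zero, ← eval₂_at_apply, ← Polynomial.eval_map]
  exact (mem_roots'.mp hb).2

end Generic

namespace AnalyticField

/-! ### Perfectoid fields -/

section Perfectoid

variable {p : ℕ} [Fact p.Prime] {F : Type u} [NormedField F] [IsAnalyticField F]

/-- Multiplying by powers of `p` moves the norm into `(|p|, 1]`. -/
theorem exists_zpow_mul_norm_mem [IsMixedChar p F] {x : F} (hx : x ≠ 0) :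
    ∃ n : ℤ, ‖(p : F)‖ < ‖(p : F) ^ n * x‖ ∧ ‖(p : F) ^ n * x‖ ≤ 1 := by
  have hp : 0 < ‖(p : F)‖ := norm_p_pos p
  obtain ⟨n, hn1, hn2⟩ := exists_mem_Ioc_zpow (norm_pos_iff.mpr hx)
    ((one_lt_inv₀ hp).mpr (norm_p_lt_one p))
  rw [inv_zpow] at hn1 hn2
  refine ⟨n + 1, ?_, ?_⟩ <;> rw [norm_mul, norm_zpow]
  · rwa [zpow_add_one₀ hp.ne', mul_assoc, mul_comm, mul_assoc, lt_mul_iff_one_lt_right hp, mul_comm,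
      ← inv_lt_iff_one_lt_mul₀' (zpow_pos hp n)]
  · rwa [← le_inv_mul_iff₀ (zpow_pos hp _), mul_one]

/-- A field of mixed characteristic that is not discretely valued has an element of norm strictly
between `|p|` and `1`: otherwise its value group is generated by `|p|`. -/
theorem exists_norm_mem_Ioo [IsMixedChar p F] (h : ¬ IsDiscretelyValued F) :
    ∃ x : F, ‖(p : F)‖ < ‖x‖ ∧ ‖x‖ < 1 := by
  by_contra! H
  refine h ⟨‖(p : F)‖, norm_p_pos p, fun x hx => ?_⟩
  obtain ⟨n, hn1, hn2⟩ := exists_zpow_mul_norm_mem (p := p) hx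
  refine ⟨-n, ?_⟩
  have := le_antisymm hn2 (H _ hn1)
  rw [norm_mul, norm_zpow] at this
  rw [zpow_neg]
  exact eq_inv_of_mul_eq_one_right this

theorem coeff_surjective_of_isPerfectoid [IsPerfectoid p F] (n : ℕ) :
    Function.Surjective (PreTilt.coeff n : NormRing p F → _) :=
  Perfection.coeff_surjective (IsPerfectoid.frobenius_surjective (p := p) (K := F)) n

/-- Every integral element of a perfectoid field is a sharp modulo `p`. -/
theorem exists_norm_sub_sharp_le [IsPerfectoid p F] {x : F} (hx : ‖x‖ ≤ 1) :
    ∃ y : NormRing p F, ‖x - sharp p F y‖ ≤ ‖(p : F)‖ := by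
  obtain ⟨y, hy⟩ := coeff_surjective_of_isPerfectoid (p := p) 0
    (Ideal.Quotient.mk _ ⟨x, mem_ringOfIntegers.mpr hx⟩)
  rw [coeff_zero_eq_mk_untilt] at hy
  exact ⟨y, (mk_eq_mk_iff p).mp hy.symm⟩

theorem norm_eq_of_norm_sub_lt {E : Type*} [SeminormedAddCommGroup E] [IsUltrametricDist E]
    {x y : E} (h : ‖x - y‖ < ‖x‖) : ‖y‖ = ‖x‖ := by
  have := IsUltrametricDist.norm_add_eq_max_of_norm_ne_norm (x := x - y) (y := -x)
    (by rw [norm_neg]; exact h.ne)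
  rwa [norm_neg, max_eq_right h.le, sub_add_eq_add_sub, add_neg_cancel, zero_sub,
    norm_neg] at this

theorem exists_norm_sharp_eq [IsPerfectoid p F] {x : F} (h1 : ‖(p : F)‖ < ‖x‖) (h2 : ‖x‖ ≤ 1) :
    ∃ y : NormRing p F, ‖sharp p F y‖ = ‖x‖ := by
  obtain ⟨y, hy⟩ := exists_norm_sub_sharp_le (p := p) h2
  exact ⟨y, norm_eq_of_norm_sub_lt (hy.trans_lt h1)⟩

variable (p F) in
/-- The tilt contains an element of norm `|p|`. -/
theorem exists_norm_sharp_eq_norm_p [IsPerfectoid p F] :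
    ∃ y : NormRing p F, ‖sharp p F y‖ = ‖(p : F)‖ := by
  obtain ⟨x, hx1, hx2⟩ := exists_norm_mem_Ioo (p := p) (IsPerfectoid.not_discrete p (K := F))
  have hp : 0 < ‖(p : F)‖ := norm_p_pos p
  have hx0 : 0 < ‖x‖ := hp.trans hx1
  obtain ⟨y, hy⟩ := exists_norm_sharp_eq hx1 hx2.le
  obtain ⟨z, hz⟩ := exists_norm_sharp_eq (p := p) (x := (p : F) / x)
    (by rw [norm_div, lt_div_iff₀ hx0]; exact mul_lt_of_lt_one_right hp hx2)
    (by rw [norm_div, div_le_one hx0]; exact hx1.le)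
  refine ⟨y * z, ?_⟩
  rw [map_mul, norm_mul, hy, hz, norm_div, mul_div_cancel₀ _ hx0.ne']

variable (p F) in
/-- The tilt of a perfectoid field, as a nontrivially normed field. -/
@[reducible]
noncomputable def tiltNontriviallyNormedField [IsPerfectoid p F] :
    NontriviallyNormedField (PerfectNormField p F) where
  __ := tiltNormedField p F
  non_trivial := by
    let := tiltNormedField p F
    obtain ⟨y, hy⟩ := exists_norm_sharp_eq_norm_p p F
    refine ⟨(algebraMap _ _ y)⁻¹, ?_⟩
    change 1 < ‖(algebraMap (NormRing p F) (PerfectNormField p F) y)⁻¹‖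
    rw [norm_inv, norm_algebraMap_normRing, hy]
    exact (one_lt_inv₀ (norm_p_pos p)).mpr (norm_p_lt_one p)

open Polynomial in
/-- The tilt of an algebraically closed perfectoid field is algebraically closed. -/
theorem tilt_isAlgClosed [IsPerfectoid p F] [IsAlgClosed F] :
    IsAlgClosed (PerfectNormField p F) := by
  let := tiltNontriviallyNormedField p F
  have : CompleteSpace (PerfectNormField p F) := tilt_completeSpace
  have : IsUltrametricDist (PerfectNormField p F) := tilt_isUltrametricDist
  refine isAlgClosed_of_forall_exists_norm_eval_lt fun f hf hd hc ε hε => ?_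
  obtain ⟨n, hn⟩ := ((tendsto_norm_p_pow_pow (p := p) (F := F)).eventually_lt_const hε).exists
  have hl : f ∈ lifts (algebraMap (NormRing p F) (PerfectNormField p F)) :=
    (lifts_iff_coeff_lifts f).mpr fun i => by
      obtain ⟨y, hy⟩ := tilt_norm_le_one_iff.mp (hc i)
      exact ⟨y, hy⟩
  obtain ⟨g, hgf, hgd, hgm⟩ := lifts_and_natDegree_eq_and_monic hl hf
  have hl' : g.map (PreTilt.coeff n) ∈
      lifts (Ideal.Quotient.mk (Ideal.span {(p : ringOfIntegers F)})) :=
    (lifts_iff_coeff_lifts _).mpr fun i => Ideal.Quotient.mk_surjective _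
  obtain ⟨G, hGg, hGd, hGm⟩ := lifts_and_natDegree_eq_and_monic hl' (hgm.map _)
  obtain ⟨x, hx⟩ := IsAlgClosed.exists_root (G.map (algebraMap (ringOfIntegers F) F)) <| by
    rw [hGm.degree_map, degree_eq_natDegree hGm.ne_zero, hGd, hgm.natDegree_map, hgd]
    exact_mod_cast hd
  obtain ⟨x, rfl⟩ : ∃ y : ringOfIntegers F, algebraMap _ F y = x :=
    IsIntegrallyClosed.isIntegral_iff.mp ⟨G, hGm, by rwa [IsRoot.def, Polynomial.eval_map] at hx⟩
  have hx' : G.eval x = 0 := by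
    rw [IsRoot.def, Polynomial.eval_map, eval₂_at_apply] at hx
    exact Subtype.ext hx
  obtain ⟨z, hz⟩ := coeff_surjective_of_isPerfectoid (p := p) n (Ideal.Quotient.mk _ x)
  refine ⟨algebraMap _ _ z, lt_of_le_of_lt ?_ hn⟩
  rw [← hgf, Polynomial.eval_map, eval₂_at_apply]
  refine (norm_algebraMap_normRing (p := p) (g.eval z)).trans_le ?_
  rw [← coeff_eq_zero_iff_norm_sharp, ← eval₂_at_apply, ← Polynomial.eval_map, hz, ← hGg,
    Polynomial.eval_map, eval₂_at_apply, hx', map_zero]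

end Perfectoid

/-! ### The completed algebraic closure -/

section CompletedAlgebraicClosure

variable (K : Type u) [NontriviallyNormedField K] [IsAnalyticField K]

/-- The algebraic closure of an analytic field; a type synonym of `AlgebraicClosure K`, which
carries the spectral norm. -/
def AlgCl : Type u := AlgebraicClosure K

noncomputable instance : NormedField (AlgCl K) := spectralNorm.normedField K (AlgebraicClosure K)

noncomputable instance : NormedAlgebra K (AlgCl K) :=
  spectralNorm.normedAlgebra K (AlgebraicClosure K)

instance : IsAlgClosed (AlgCl K) := inferInstanceAs (IsAlgClosed (AlgebraicClosure K))

instance : Algebra.IsAlgebraic K (AlgCl K) :=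
  inferInstanceAs (Algebra.IsAlgebraic K (AlgebraicClosure K))

instance : IsUltrametricDist (AlgCl K) :=
  IsUltrametricDist.isUltrametricDist_of_forall_norm_add_le_max_norm
    (isNonarchimedean_spectralNorm (K := K) (L := AlgebraicClosure K))

theorem AlgCl.norm_def (x : AlgCl K) : ‖x‖ = spectralNorm K (AlgCl K) x := rfl

/-- The identity of `AlgebraicClosure K`. -/
noncomputable def AlgCl.equiv : AlgebraicClosure K ≃ₐ[K] AlgCl K :=
  AlgEquiv.refl

/-- The completed algebraic closure `C` of an analytic field. -/
abbrev CAlgCl : Type u := UniformSpace.Completion (AlgCl K)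

instance : IsUltrametricDist (CAlgCl K) := IsUltrametricDist.of_normedAlgebra K

instance : IsAnalyticField (CAlgCl K) where

variable {K}

theorem norm_algebraMap_CAlgCl (x : K) : ‖algebraMap K (CAlgCl K) x‖ = ‖x‖ := norm_algebraMap' _ x

theorem coe_algebraMap (x : K) : ((algebraMap K (AlgCl K) x : AlgCl K) : CAlgCl K) =
    algebraMap K (CAlgCl K) x := rfl

theorem coe_eq_algebraMap (x : AlgCl K) : (x : CAlgCl K) = algebraMap (AlgCl K) (CAlgCl K) x := rfl

theorem norm_coe_CAlgCl (x : AlgCl K) : ‖(x : CAlgCl K)‖ = ‖x‖ := UniformSpace.Completion.norm_coe x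

theorem coe_CAlgCl_injective : Function.Injective ((↑) : AlgCl K → CAlgCl K) :=
  UniformSpace.Completion.coe_injective _

variable (p : ℕ) [Fact p.Prime]

instance [IsMixedChar p K] : IsMixedChar p (CAlgCl K) := IsMixedChar.of_norm p _ <| by
  rw [← IsMixedChar.norm_p (p := p) (K := K), ← norm_algebraMap_CAlgCl, map_natCast]

theorem norm_p_CAlgCl [IsMixedChar p K] : ‖(p : CAlgCl K)‖ = ‖(p : K)‖ := by
  rw [IsMixedChar.norm_p (p := p) (K := K), IsMixedChar.norm_p]

theorem charZero_of_isMixedChar (F : Type u) [NormedField F] [IsAnalyticField F]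
    [IsMixedChar p F] : CharZero F := by
  obtain ⟨q, hq⟩ := CharP.exists F
  rcases Nat.eq_zero_or_pos q with rfl | h0
  · exact CharP.charP_to_charZero F
  · exfalso
    have : Fact q.Prime := ⟨(CharP.char_is_prime_or_zero F q).resolve_right h0.ne'⟩
    have hpq : p.Coprime q := by
      rw [Nat.coprime_primes Fact.out Fact.out]
      rintro rfl
      exact p_ne_zero (F := F) p (CharP.cast_eq_zero F p)
    -- `a * p = 1` in `F` for some natural number `a`, which contradicts `‖p‖ < 1`.
    obtain ⟨a, ha⟩ := Nat.exists_mul_mod_eq_one_of_coprime hpq (Fact.out : q.Prime).one_lt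
    have h1 : (p : F) * (a : F) = 1 := by
      rw [← Nat.cast_mul, ← Nat.mod_add_div (p * a) q, ha.2]
      simp
    have h2 : ‖(a : F)‖ ≤ 1 := by
      have := norm_coe_le_one (a : ringOfIntegers F)
      simpa using this
    have h3 : ‖(p : F)‖ * ‖(a : F)‖ = 1 := by rw [← norm_mul, h1, norm_one]
    have := mul_lt_one_of_nonneg_of_lt_one_left (norm_nonneg _) (norm_p_lt_one (F := F) p) h2
    exact this.ne h3

/-- The completion of an algebraically closed field of characteristic zero is algebraically closed,
by Krasner's lemma. -/
theorem CAlgCl_isAlgClosed [IsMixedChar p K] : IsAlgClosed (CAlgCl K) := by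
  have := charZero_of_isMixedChar p (CAlgCl K)
  let : NontriviallyNormedField (CAlgCl K) :=
    { (inferInstance : NormedField (CAlgCl K)) with
      non_trivial := by
        obtain ⟨x, hx⟩ := NontriviallyNormedField.non_trivial (α := K)
        exact ⟨algebraMap K (CAlgCl K) x, hx.trans_eq (norm_algebraMap_CAlgCl x).symm⟩ }
  exact IsAlgClosed.of_denseRange (K := AlgCl K) (L := CAlgCl K)
    UniformSpace.Completion.denseRange_coe

/-- An algebraically closed field of mixed characteristic that contains a perfectoid field is
perfectoid. -/
theorem IsPerfectoid.of_isAlgClosed {F E : Type u} [NormedField F] [IsAnalyticField F]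
    [NormedField E] [IsAnalyticField E] [IsPerfectoid p F] [IsMixedChar p E] [IsAlgClosed E]
    (f : F →+* E) (hf : ∀ x, ‖f x‖ = ‖x‖) : IsPerfectoid p E where
  not_discrete := fun ⟨r, hr, h⟩ => IsPerfectoid.not_discrete p (K := F)
    ⟨r, hr, fun x hx => by
      rw [← hf]
      exact h _ ((map_ne_zero f).mpr hx)⟩
  frobenius_surjective x := by
    obtain ⟨x, rfl⟩ := Ideal.Quotient.mk_surjective x
    obtain ⟨y, hy⟩ := IsAlgClosed.exists_pow_nat_eq (x : E) (Fact.out : p.Prime).pos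
    have hy1 : ‖y‖ ≤ 1 := by
      rw [← pow_le_one_iff_of_nonneg (norm_nonneg y) (Fact.out : p.Prime).ne_zero, ← norm_pow, hy]
      exact norm_coe_le_one x
    refine ⟨Ideal.Quotient.mk _ ⟨y, mem_ringOfIntegers.mpr hy1⟩, ?_⟩
    change _ ^ p = _
    rw [← map_pow]
    exact congrArg _ (Subtype.ext hy)

variable [IsPerfectoid p K]

instance : IsPerfectoid p (CAlgCl K) :=
  have : IsAlgClosed (CAlgCl K) := CAlgCl_isAlgClosed p
  IsPerfectoid.of_isAlgClosed p (algebraMap K (CAlgCl K)) norm_algebraMap_CAlgCl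

variable (K) in
/-- The tilt `C'` of the completed algebraic closure. -/
abbrev TiltC : Type u := PerfectNormField p (CAlgCl K)

theorem tiltC_isAlgClosed : IsAlgClosed (TiltC K p) :=
  have : IsAlgClosed (CAlgCl K) := CAlgCl_isAlgClosed p
  tilt_isAlgClosed

variable (K) in
/-- The map `𝔬_{K'} → 𝔬_{C'}`. -/
noncomputable abbrev baseMap : NormRing p K →+* NormRing p (CAlgCl K) :=
  normRingMap p (algebraMap K (CAlgCl K)) norm_algebraMap_CAlgCl

/-- The tilt of the completed algebraic closure is an extension of the tilt. -/
noncomputable instance : Algebra (PerfectNormField p K) (TiltC K p) :=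
  (perfectNormFieldMap p (algebraMap K (CAlgCl K)) norm_algebraMap_CAlgCl).toAlgebra

theorem algebraMap_tiltC_algebraMap (x : NormRing p K) :
    algebraMap (PerfectNormField p K) (TiltC K p) (algebraMap _ _ x) =
      algebraMap _ _ (baseMap K p x) :=
  perfectNormFieldMap_algebraMap p _ _ x

theorem sharp_baseMap (x : NormRing p K) :
    sharp p (CAlgCl K) (baseMap K p x) = algebraMap K (CAlgCl K) (sharp p K x) :=
  sharp_normRingMap _ _ x

theorem perfectNorm_algebraMap_tiltC (x : PerfectNormField p K) :
    perfectNorm p (CAlgCl K) (algebraMap (PerfectNormField p K) (TiltC K p) x) =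
      perfectNorm p K x :=
  perfectNorm_map _ _ x

variable (K) in
/-- The tilt of the completed algebraic closure is a normed algebra over the tilt. -/
@[reducible]
noncomputable def tiltNormedAlgebra :
    letI := tiltNormedField p K
    letI := tiltNormedField p (CAlgCl K)
    NormedAlgebra (PerfectNormField p K) (TiltC K p) :=
  letI := tiltNormedField p K
  letI := tiltNormedField p (CAlgCl K)
  { (inferInstance : Algebra (PerfectNormField p K) (TiltC K p)) with
    norm_smul_le := fun r x => by
      rw [Algebra.smul_def, norm_mul]
      refine le_of_eq (congrArg (· * ‖x‖) ?_)
      exact congrArg NNReal.toReal (perfectNorm_algebraMap_tiltC p r) }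

end CompletedAlgebraicClosure

/-! ### Subrings of `𝔬_C` given by Witt vectors -/

section Theta

variable {p : ℕ} [Fact p.Prime]

/-- Ring homomorphisms from the Witt vectors of a perfect ring to a `p`-adically separated ring
that agree on Teichmüller representatives are equal. -/
theorem wittVector_ringHom_ext {R S : Type*} [CommRing R] [CommRing S] [CharP R p]
    [PerfectRing R p] [IsHausdorff (Ideal.span {(p : S)}) S] {f g : WittVector p R →+* S}
    (h : ∀ x, f (WittVector.teichmuller p x) = g (WittVector.teichmuller p x)) : f = g := by
  refine RingHom.ext fun w => ?_
  rw [IsHausdorff.eq_iff_smodEq (I := Ideal.span {(p : S)})]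
  intro n
  rw [SModEq.sub_mem, smul_eq_mul, Ideal.mul_top, ← Ideal.Quotient.eq]
  refine RingHom.congr_fun (WittVector.eq_of_apply_teichmuller_eq
    ((Ideal.Quotient.mk (Ideal.span {(p : S)} ^ n)).comp f)
    ((Ideal.Quotient.mk _).comp g) ⟨n, ?_⟩ fun x => congrArg _ (h x)) w
  rw [← map_natCast (Ideal.Quotient.mk (Ideal.span {(p : S)} ^ n)), ← map_pow,
    Ideal.Quotient.eq_zero_iff_mem]
  exact Ideal.pow_mem_pow (Ideal.mem_span_singleton_self _) n

theorem integersMap_untilt {F E : Type u} [NormedField F] [IsAnalyticField F]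
    [NormedField E] [IsAnalyticField E] [IsMixedChar p F] [IsMixedChar p E]
    (f : F →+* E) (hf : ∀ x, ‖f x‖ = ‖x‖) (y : NormRing p F) :
    PreTilt.untilt (normRingMap p f hf y) = integersMap f hf (PreTilt.untilt y) :=
  Subtype.ext (sharp_normRingMap f hf y)

theorem fontaineTheta_map_normRingMap {F E : Type u} [NormedField F] [IsAnalyticField F]
    [NormedField E] [IsAnalyticField E] [IsMixedChar p F] [IsMixedChar p E]
    (f : F →+* E) (hf : ∀ x, ‖f x‖ = ‖x‖) (w : WittVector p (NormRing p F)) :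
    WittVector.fontaineTheta (ringOfIntegers E) p (WittVector.map (normRingMap p f hf) w) =
      integersMap f hf (WittVector.fontaineTheta (ringOfIntegers F) p w) := by
  refine RingHom.congr_fun (f := (WittVector.fontaineTheta (ringOfIntegers E) p).comp
    (WittVector.map (normRingMap p f hf))) (g := (integersMap f hf).comp
    (WittVector.fontaineTheta (ringOfIntegers F) p)) (wittVector_ringHom_ext fun x => ?_) w
  simp only [RingHom.comp_apply, WittVector.map_teichmuller, WittVector.fontaineTheta_teichmuller,
    integersMap_untilt]

variable {K : Type u} [NontriviallyNormedField K] [IsAnalyticField K] [IsPerfectoid p K]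

/-- The ring of integers of a subfield of the tilt of `C`. -/
noncomputable def intSubring (E : IntermediateField (PerfectNormField p K) (TiltC K p)) :
    Subring (NormRing p (CAlgCl K)) :=
  E.toSubring.comap (algebraMap _ (TiltC K p))

theorem mem_intSubring {E : IntermediateField (PerfectNormField p K) (TiltC K p)}
    {y : NormRing p (CAlgCl K)} : y ∈ intSubring E ↔ algebraMap _ (TiltC K p) y ∈ E := Iff.rfl

theorem baseMap_mem (E : IntermediateField (PerfectNormField p K) (TiltC K p)) (y : NormRing p K) :
    baseMap K p y ∈ intSubring E := by
  rw [mem_intSubring, ← algebraMap_tiltC_algebraMap]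
  exact E.algebraMap_mem _

/-- The image in `𝔬_C` of the Witt vectors of the integers of a subfield `E` of the tilt. For
`E` finite over `K'` it is the ring of integers of the finite extension of `K` with tilt `E`. -/
noncomputable def thetaRange (E : IntermediateField (PerfectNormField p K) (TiltC K p)) :
    Subring (ringOfIntegers (CAlgCl K)) :=
  ((WittVector.fontaineTheta (ringOfIntegers (CAlgCl K)) p).comp
    (WittVector.map (intSubring E).subtype)).range

variable (E : IntermediateField (PerfectNormField p K) (TiltC K p))

theorem untilt_mem_thetaRange {y : NormRing p (CAlgCl K)} (hy : y ∈ intSubring E) :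
    PreTilt.untilt y ∈ thetaRange E :=
  ⟨WittVector.teichmuller p ⟨y, hy⟩, by
    rw [RingHom.comp_apply, WittVector.map_teichmuller, WittVector.fontaineTheta_teichmuller]
    rfl⟩

theorem integersMap_mem_thetaRange (x : ringOfIntegers K) :
    integersMap (algebraMap K (CAlgCl K)) norm_algebraMap_CAlgCl x ∈ thetaRange E := by
  obtain ⟨w, rfl⟩ := surjective_fontaineTheta (R := ringOfIntegers K) (p := p)
    IsPerfectoid.frobenius_surjective x
  refine ⟨WittVector.map ((baseMap K p).codRestrict (intSubring E) (baseMap_mem E)) w, ?_⟩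
  rw [← fontaineTheta_map_normRingMap, RingHom.comp_apply]
  refine congrArg _ (WittVector.ext fun n => ?_)
  simp only [WittVector.map_coeff]
  rfl

theorem root_mem_intSubring [Algebra.IsAlgebraic (PerfectNormField p K) E]
    {y : NormRing p (CAlgCl K)} (hy : y ∈ intSubring E) (n : ℕ) : root p n y ∈ intSubring E := by
  have : PerfectField E := Algebra.IsAlgebraic.perfectField (PerfectNormField p K)
  have : CharP E p := charP_of_injective_algebraMap
    (algebraMap (PerfectNormField p K) E).injective p
  have : PerfectRing E p := PerfectField.toPerfectRing p
  obtain ⟨e, he⟩ := (bijective_iterateFrobenius E p n).2 ⟨_, mem_intSubring.mp hy⟩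
  have h : algebraMap _ (TiltC K p) (root p n y) = e := by
    refine (bijective_iterateFrobenius (TiltC K p) p n).1 ?_
    rw [iterateFrobenius_def, ← map_pow, root_pow, iterateFrobenius_def]
    rw [iterateFrobenius_def] at he
    exact (congrArg Subtype.val he).symm
  rw [mem_intSubring, h]
  exact e.2

instance [Algebra.IsAlgebraic (PerfectNormField p K) E] : PerfectRing (intSubring E) p :=
  PerfectRing.ofSurjective _ _ fun y => ⟨⟨root p 1 y, root_mem_intSubring E y.2 1⟩,
    Subtype.ext (by
      change root p 1 (y : NormRing p (CAlgCl K)) ^ p = y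
      simpa using root_pow 1 (y : NormRing p (CAlgCl K)))⟩

variable [Algebra.IsAlgebraic (PerfectNormField p K) E]

/-- Splitting off the leading term of a Teichmüller expansion. -/
theorem exists_eq_untilt_add {a : ringOfIntegers (CAlgCl K)} (ha : a ∈ thetaRange E) :
    ∃ y ∈ intSubring E, ∃ b ∈ thetaRange E, a = PreTilt.untilt y + p * b := by
  obtain ⟨w, rfl⟩ := ha
  obtain ⟨v, hv⟩ := WittVector.dvd_sub_sum_teichmuller_iterateFrobeniusEquiv_coeff w 0
  refine ⟨w.coeff 0, (w.coeff 0).2, _, ⟨v, rfl⟩, ?_⟩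
  rw [sub_eq_iff_eq_add'] at hv
  conv_lhs => rw [hv]
  have h0 : Finset.Iic (0 : ℕ) = {0} := rfl
  simp only [h0, Finset.sum_singleton, pow_zero, mul_one, zero_add, pow_one, map_add, map_mul,
    map_natCast]
  congr 1
  rw [RingHom.comp_apply, RingAut.one_apply, WittVector.map_teichmuller,
    WittVector.fontaineTheta_teichmuller]
  rfl

/-- `thetaRange E` is `p`-saturated in `𝔬_C`: if `p` divides `y♯ + p b`, then `y` is divisible in
`𝔬_E` by an element of `𝔬_{K'}` of norm `|p|`. -/
theorem exists_eq_p_mul {a : ringOfIntegers (CAlgCl K)} (ha : a ∈ thetaRange E)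
    (hn : ‖(a : CAlgCl K)‖ ≤ ‖(p : CAlgCl K)‖) : ∃ b ∈ thetaRange E, a = p * b := by
  obtain ⟨y, hy, b, hb, rfl⟩ := exists_eq_untilt_add E ha
  obtain ⟨ϖ, hϖ⟩ := exists_norm_sharp_eq_norm_p p K
  have hϖ' : ‖sharp p (CAlgCl K) (baseMap K p ϖ)‖ = ‖(p : CAlgCl K)‖ := by
    rw [sharp_baseMap, norm_algebraMap_CAlgCl, hϖ, norm_p_CAlgCl]
  have hy1 : ‖sharp p (CAlgCl K) y‖ ≤ ‖(p : CAlgCl K)‖ := by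
    rw [← coe_untilt, ← p_dvd_iff, ← dvd_add_left (dvd_mul_right _ b), p_dvd_iff]
    exact hn
  obtain ⟨z, rfl⟩ := dvd_of_norm_sharp_le (hy1.trans_eq hϖ'.symm)
  have hϖ0 : baseMap K p ϖ ≠ 0 := by
    rw [← sharp_eq_zero.ne, ← norm_pos_iff, hϖ']
    exact norm_p_pos p
  have hz : z ∈ intSubring E := by
    have h0 : algebraMap _ (TiltC K p) (baseMap K p ϖ) ≠ 0 := fun h =>
      hϖ0 (algebraMap_normRing_injective (h.trans (map_zero _).symm))
    rw [mem_intSubring, ← mul_div_cancel_left₀ (algebraMap _ (TiltC K p) z) h0, ← map_mul]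
    exact E.div_mem hy (baseMap_mem E ϖ)
  obtain ⟨c, hc⟩ : (p : ringOfIntegers K) ∣ PreTilt.untilt ϖ := (p_dvd_iff p).mpr hϖ.le
  refine ⟨integersMap (algebraMap K (CAlgCl K)) norm_algebraMap_CAlgCl c * PreTilt.untilt z + b,
    add_mem (mul_mem (integersMap_mem_thetaRange E c) (untilt_mem_thetaRange E hz)) hb, ?_⟩
  rw [map_mul, integersMap_untilt, hc, map_mul, map_natCast]
  ring

end Theta

end AnalyticField

/-! ### Integral elements of finite extensions of complete fields -/

/-- Coordinates on a finite extension of a complete field are bounded, so after scaling by a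
constant, integral elements are integral combinations of a fixed finite family. -/
theorem IntermediateField.exists_integral_coordinates {k D : Type*} [NontriviallyNormedField k]
    [CompleteSpace k] [NormedField D] [NormedAlgebra k D] (E : IntermediateField k D)
    [FiniteDimensional k E] : ∃ (n : ℕ) (b : Fin n → D) (c : k), c ≠ 0 ∧ ‖c‖ ≤ 1 ∧
      (∀ i, b i ∈ E ∧ ‖b i‖ ≤ 1) ∧ ∀ x ∈ E, ‖x‖ ≤ 1 → ∃ a : Fin n → k,
        (∀ i, ‖a i‖ ≤ 1) ∧ algebraMap k D c * x = ∑ i, algebraMap k D (a i) * b i := by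
  let V : Submodule k D := Subalgebra.toSubmodule E.toSubalgebra
  have : FiniteDimensional k V := inferInstanceAs (FiniteDimensional k E)
  let e := Module.finBasis k V
  let φ : V →L[k] (Fin (Module.finrank k V) → k) := e.equivFunL.toContinuousLinearMap
  have hφ : ∀ v i, ‖e.repr v i‖ ≤ ‖φ‖ * ‖v‖ := fun v i =>
    (norm_le_pi_norm (φ v) i).trans (φ.le_opNorm v)
  have key : ∀ B : ℝ, 0 ≤ B → ∃ c : k, c ≠ 0 ∧ ‖c‖ ≤ 1 ∧ ‖c‖ * B ≤ 1 := fun B hB => by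
    obtain ⟨c, hc0, hc⟩ := NormedField.exists_norm_lt k
      (inv_pos.mpr (zero_lt_one.trans_le (le_max_right B 1)))
    have hm : 0 < max B 1 := zero_lt_one.trans_le (le_max_right B 1)
    exact ⟨c, norm_pos_iff.mp hc0, hc.le.trans (inv_le_one_of_one_le₀ (le_max_right _ _)),
      (mul_le_mul hc.le (le_max_left B 1) hB (inv_pos.mpr hm).le).trans
        (inv_mul_cancel₀ hm.ne').le⟩
  obtain ⟨c₁, h₁0, h₁1, h₁⟩ := key ‖φ‖ (norm_nonneg _)
  obtain ⟨c₂, h₂0, h₂1, h₂⟩ := key (∑ i, ‖e i‖) (Finset.sum_nonneg fun _ _ => norm_nonneg _)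
  refine ⟨_, fun i => algebraMap k D c₂ * (e i : D), c₁ * c₂, mul_ne_zero h₁0 h₂0, ?_,
    fun i => ⟨E.mul_mem (E.algebraMap_mem _) (e i).2, ?_⟩, fun x hx hx1 => ?_⟩
  · rw [norm_mul]
    exact mul_le_one₀ h₁1 (norm_nonneg _) h₂1
  · rw [norm_mul, norm_algebraMap']
    refine (mul_le_mul_of_nonneg_left ?_ (norm_nonneg _)).trans h₂
    exact Finset.single_le_sum (f := fun i => ‖e i‖) (fun _ _ => norm_nonneg _) (Finset.mem_univ i)
  · refine ⟨fun i => c₁ * e.repr ⟨x, hx⟩ i, fun i => ?_, ?_⟩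
    · rw [norm_mul]
      refine (mul_le_mul_of_nonneg_left ?_ (norm_nonneg _)).trans h₁
      exact (hφ _ i).trans (mul_le_of_le_one_right (norm_nonneg _) hx1)
    · have h := congrArg Subtype.val (e.sum_repr ⟨x, hx⟩)
      rw [Submodule.coe_sum] at h
      conv_lhs => rw [← show _ = x from h]
      rw [Finset.mul_sum]
      refine Finset.sum_congr rfl fun i _ => ?_
      rw [Submodule.coe_smul, Algebra.smul_def, map_mul, map_mul]
      ring

namespace AnalyticField

/-! ### Untilting finite extensions of the tilt -/

section Untilt

variable {p : ℕ} [Fact p.Prime]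
variable {K : Type u} [NontriviallyNormedField K] [IsAnalyticField K] [IsPerfectoid p K]
variable (E : IntermediateField (PerfectNormField p K) (TiltC K p))

theorem root_add {F : Type u} [NormedField F] [IsAnalyticField F] [IsMixedChar p F] (n : ℕ)
    (x y : NormRing p F) : root p n (x + y) = root p n x + root p n y :=
  iterate_map_add _ n x y

theorem root_mul {F : Type u} [NormedField F] [IsAnalyticField F] [IsMixedChar p F] (n : ℕ)
    (x y : NormRing p F) : root p n (x * y) = root p n x * root p n y :=
  iterate_map_mul _ n x y

theorem root_sum {F : Type u} [NormedField F] [IsAnalyticField F] [IsMixedChar p F] (n : ℕ)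
    {ι : Type*} (s : Finset ι) (x : ι → NormRing p F) :
    root p n (∑ i ∈ s, x i) = ∑ i ∈ s, root p n (x i) :=
  map_sum (AddMonoidHom.mk' (root p n) (root_add n)) x s

/-- Almost étaleness in characteristic `p`: extracting `p`-power roots brings the constant of
`IntermediateField.exists_integral_coordinates` as close to `1` as desired. -/
theorem exists_almost_coordinates [FiniteDimensional (PerfectNormField p K) E] :
    ∃ (c : NormRing p K) (n : ℕ) (b : Fin n → NormRing p (CAlgCl K)), ‖(p : K)‖ < ‖sharp p K c‖ ∧
      (∀ i, b i ∈ intSubring E) ∧ ∀ x ∈ intSubring E, ∃ a : Fin n → NormRing p K,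
        baseMap K p c * x = ∑ i, baseMap K p (a i) * b i := by
  let := tiltNontriviallyNormedField p K
  let := tiltNormedField p (CAlgCl K)
  let := tiltNormedAlgebra K p
  have : CompleteSpace (PerfectNormField p K) := tilt_completeSpace
  obtain ⟨n, b, c, hc0, hc1, hb, hE⟩ := E.exists_integral_coordinates
  obtain ⟨c, rfl⟩ := tilt_norm_le_one_iff.mp hc1
  choose b' hb' using fun i => tilt_norm_le_one_iff.mp (hb i).2
  have hc : 0 < ‖sharp p K c‖ := by
    rw [norm_pos_iff, sharp_eq_zero.ne]
    rintro rfl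
    exact hc0 (map_zero _)
  obtain ⟨k, hk⟩ := ((tendsto_norm_p_pow_pow (p := p) (F := K)).eventually_lt_const hc).exists
  refine ⟨root p k c, n, fun i => root p k (b' i), ?_, fun i => ?_, fun x hx => ?_⟩
  · rw [← sharp_root_pow k c, norm_pow] at hk
    exact lt_of_pow_lt_pow_left₀ _ (norm_nonneg _) hk
  · refine root_mem_intSubring E ?_ k
    rw [mem_intSubring, hb']
    exact (hb i).1
  · obtain ⟨a, ha1, ha⟩ := hE (algebraMap _ _ (x ^ p ^ k)) (pow_mem hx _)
      (tilt_norm_le_one_iff.mpr ⟨_, rfl⟩)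
    choose a' ha' using fun i => tilt_norm_le_one_iff.mp (ha1 i)
    refine ⟨fun i => root p k (a' i), ?_⟩
    have h : baseMap K p c * x ^ p ^ k = ∑ i, baseMap K p (a' i) * b' i := by
      refine algebraMap_normRing_injective ?_
      rw [map_mul, map_sum, ← algebraMap_tiltC_algebraMap]
      refine ha.trans (Finset.sum_congr rfl fun i _ => ?_)
      rw [map_mul, ← algebraMap_tiltC_algebraMap, ha', hb']
    have h2 := congrArg (root p k) h
    rw [root_mul, root_pow_pow, root_sum, baseMap, root_normRingMap] at h2
    rw [h2]
    exact Finset.sum_congr rfl fun i _ => by rw [root_mul, root_normRingMap]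

/-- The elements of `C` with denominators a power of `p` over `thetaRange E`. -/
def thetaSubalgebra : Subalgebra K (CAlgCl K) where
  carrier := {x | ∃ n : ℕ, ∃ a ∈ thetaRange E, (a : CAlgCl K) = (p : CAlgCl K) ^ n * x}
  mul_mem' := by
    rintro x y ⟨n, a, ha, hx⟩ ⟨m, b, hb, hy⟩
    refine ⟨n + m, a * b, mul_mem ha hb, ?_⟩
    rw [MulMemClass.coe_mul, hx, hy]
    ring
  add_mem' := by
    rintro x y ⟨n, a, ha, hx⟩ ⟨m, b, hb, hy⟩
    refine ⟨n + m, p ^ m * a + p ^ n * b, add_mem (mul_mem (pow_mem (natCast_mem _ _) _) ha)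
      (mul_mem (pow_mem (natCast_mem _ _) _) hb), ?_⟩
    simp only [AddMemClass.coe_add, MulMemClass.coe_mul, SubmonoidClass.coe_pow, hx, hy]
    simp only [SubringClass.coe_natCast]
    ring
  algebraMap_mem' x := by
    obtain ⟨n, hn⟩ : ∃ n : ℕ, ‖(p : K) ^ n * x‖ ≤ 1 := by
      have h : Filter.Tendsto (fun n : ℕ => ‖(p : K)‖ ^ n * ‖x‖) Filter.atTop (nhds (0 * ‖x‖)) :=
        (tendsto_pow_atTop_nhds_zero_of_lt_one (norm_nonneg _) (norm_p_lt_one p)).mul_const _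
      rw [zero_mul] at h
      obtain ⟨n, hn⟩ := (h.eventually_le_const zero_lt_one).exists
      exact ⟨n, by rwa [norm_mul, norm_pow]⟩
    refine ⟨n, _, integersMap_mem_thetaRange E ⟨_, mem_ringOfIntegers.mpr hn⟩, ?_⟩
    change algebraMap K (CAlgCl K) _ = _
    rw [map_mul, map_pow, map_natCast]

theorem exists_eq_p_pow_mul [Algebra.IsAlgebraic (PerfectNormField p K) E] (n : ℕ)
    {a : ringOfIntegers (CAlgCl K)} (ha : a ∈ thetaRange E)
    (hn : ‖(a : CAlgCl K)‖ ≤ ‖(p : CAlgCl K)‖ ^ n) :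
    ∃ b ∈ thetaRange E, a = p ^ n * b := by
  induction n generalizing a with
  | zero => exact ⟨a, ha, by simp⟩
  | succ n ih =>
    have hp := norm_p_pos (F := CAlgCl K) p
    obtain ⟨b, hb, rfl⟩ := exists_eq_p_mul E ha <| hn.trans <|
      pow_le_of_le_one hp.le (norm_p_lt_one p).le n.succ_ne_zero
    obtain ⟨d, hd, rfl⟩ := ih hb <| by
      rw [← p_pow_dvd_iff] at hn ⊢
      rw [pow_succ'] at hn
      refine (mul_dvd_mul_iff_left ?_).mp hn
      exact fun h => p_ne_zero (F := CAlgCl K) p (by simpa using congrArg Subtype.val h)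
    exact ⟨d, hd, by ring⟩

theorem exists_mem_thetaRange_of_norm_le_one [Algebra.IsAlgebraic (PerfectNormField p K) E]
    {x : CAlgCl K} (hx : x ∈ thetaSubalgebra E) (hx1 : ‖x‖ ≤ 1) :
    ∃ a ∈ thetaRange E, (a : CAlgCl K) = x := by
  obtain ⟨n, a, ha, hax⟩ := hx
  obtain ⟨b, hb, rfl⟩ := exists_eq_p_pow_mul E n ha <| by
    rw [hax, norm_mul, norm_pow]
    exact mul_le_of_le_one_right (by positivity) hx1
  refine ⟨b, hb, mul_left_cancel₀ (pow_ne_zero n (p_ne_zero (F := CAlgCl K) p)) ?_⟩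
  simpa using hax

/-- If integral elements of `E` are combinations of finitely many elements `b i` up to a constant
of norm larger than `|p|`, then the sharps of the `b i` span the untilt: each element of
`thetaRange E` lies in the span up to a multiple of a fixed constant of norm less than `1`,
and a finite dimensional subspace is closed. -/
theorem thetaRange_le_span [Algebra.IsAlgebraic (PerfectNormField p K) E] {c : NormRing p K} {n : ℕ}
    {b : Fin n → NormRing p (CAlgCl K)} (hc : ‖(p : K)‖ < ‖sharp p K c‖)
    (hb : ∀ i, b i ∈ intSubring E)
    (h : ∀ x ∈ intSubring E, ∃ a : Fin n → NormRing p K,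
      baseMap K p c * x = ∑ i, baseMap K p (a i) * b i)
    {a : ringOfIntegers (CAlgCl K)} (ha : a ∈ thetaRange E) :
    (a : CAlgCl K) ∈ Submodule.span K (Set.range fun i => sharp p (CAlgCl K) (b i)) := by
  set V := Submodule.span K (Set.range fun i => sharp p (CAlgCl K) (b i)) with hV
  have hγ : sharp p K c ≠ 0 := norm_pos_iff.mp ((norm_nonneg _).trans_lt hc)
  set ρ : K := (p : K) / sharp p K c with hρ
  have hρ1 : ‖ρ‖ < 1 := by
    rw [hρ, norm_div, div_lt_one (norm_pos_iff.mpr hγ)]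
    exact hc
  have step : ∀ a ∈ thetaRange E, ∃ v ∈ V, ∃ a' ∈ thetaRange E,
    (a : CAlgCl K) = v + ρ • (a' : CAlgCl K) := by
    intro a ha
    obtain ⟨y, hy, a₁, ha₁, rfl⟩ := exists_eq_untilt_add E ha
    obtain ⟨d, hd⟩ := h y hy
    have hm : PreTilt.untilt (∑ i, baseMap K p (d i) * b i) -
        ∑ i, PreTilt.untilt (baseMap K p (d i)) * PreTilt.untilt (b i) ∈ thetaRange E := by
      refine sub_mem (untilt_mem_thetaRange E (sum_mem fun i _ =>
        mul_mem (baseMap_mem E _) (hb i))) (sum_mem fun i _ => mul_mem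
          (untilt_mem_thetaRange E (baseMap_mem E _)) (untilt_mem_thetaRange E (hb i)))
    obtain ⟨a₂, ha₂, h₂⟩ := exists_eq_p_mul E hm <| by
      rw [← p_dvd_iff, ← Ideal.mem_span_singleton, ← Ideal.Quotient.eq]
      simp only [map_sum, map_mul, ← coeff_zero_eq_mk_untilt]
    refine ⟨(sharp p K c)⁻¹ • ∑ i, sharp p K (d i) • sharp p (CAlgCl K) (b i),
      V.smul_mem _ (V.sum_mem fun i _ => V.smul_mem _ (Submodule.subset_span ⟨i, rfl⟩)),
      a₂ + PreTilt.untilt (baseMap K p c) * a₁,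
      add_mem ha₂ (mul_mem (untilt_mem_thetaRange E (baseMap_mem E c)) ha₁), ?_⟩
    rw [← hd, map_mul, sub_eq_iff_eq_add] at h₂
    have h₃ := congrArg Subtype.val h₂
    simp only [MulMemClass.coe_mul, AddMemClass.coe_add, AddSubmonoidClass.coe_finsetSum,
      coe_untilt, sharp_baseMap, SubringClass.coe_natCast] at h₃ ⊢
    have hγ' : algebraMap K (CAlgCl K) (sharp p K c) ≠ 0 := (map_ne_zero _).mpr hγ
    simp only [Algebra.smul_def, hρ, map_div₀, map_inv₀, map_natCast]
    rw [eq_comm, ← sub_eq_zero] at h₃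
    field_simp
    linear_combination -h₃
  have iter : ∀ m : ℕ, ∀ a ∈ thetaRange E, ∃ v ∈ V, ∃ a' ∈ thetaRange E,
      (a : CAlgCl K) = v + ρ ^ m • (a' : CAlgCl K) := by
    intro m
    induction m with
    | zero => exact fun a ha => ⟨0, V.zero_mem, a, ha, by simp⟩
    | succ m ih =>
      intro a ha
      obtain ⟨v, hv, a', ha', e⟩ := ih a ha
      obtain ⟨v', hv', a'', ha'', e'⟩ := step a' ha'
      exact ⟨v + ρ ^ m • v', V.add_mem hv (V.smul_mem _ hv'), a'', ha'', by
        rw [e, e', smul_add, smul_smul, ← pow_succ, add_assoc]⟩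
  have : FiniteDimensional K V := FiniteDimensional.span_of_finite K (Set.finite_range _)
  have hcl : IsClosed (V : Set (CAlgCl K)) := V.closed_of_finiteDimensional
  rw [← SetLike.mem_coe, ← hcl.closure_eq, Metric.mem_closure_iff]
  intro ε hε
  obtain ⟨m, hm⟩ := ((tendsto_pow_atTop_nhds_zero_of_lt_one (norm_nonneg ρ)
    hρ1).eventually_lt_const hε).exists
  obtain ⟨v, hv, a', ha', e⟩ := iter m a ha
  refine ⟨v, hv, lt_of_le_of_lt ?_ hm⟩
  rw [dist_eq_norm, e, add_sub_cancel_left, norm_smul, norm_pow]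
  exact mul_le_of_le_one_right (by positivity) (norm_coe_le_one a')

theorem finite_thetaSubalgebra [FiniteDimensional (PerfectNormField p K) E] :
    Module.Finite K (thetaSubalgebra E) := by
  obtain ⟨c, n, b, hc, hb, h⟩ := exists_almost_coordinates E
  set V := Submodule.span K (Set.range fun i => sharp p (CAlgCl K) (b i)) with hV
  have : FiniteDimensional K V := FiniteDimensional.span_of_finite K (Set.finite_range _)
  have hle : Subalgebra.toSubmodule (thetaSubalgebra E) ≤ V := by
    rintro x ⟨m, a, ha, hax⟩
    have h1 := thetaRange_le_span E hc hb h ha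
    have h2 : x = ((p : K) ^ m)⁻¹ • (a : CAlgCl K) := by
      rw [hax, Algebra.smul_def, map_inv₀, map_pow, map_natCast,
        inv_mul_cancel_left₀ (pow_ne_zero _ (p_ne_zero p))]
    rw [h2]
    exact V.smul_mem _ h1
  exact Submodule.finiteDimensional_of_le hle

/-- Elements of `C` algebraic over `K` lie in the algebraic closure of `K`. -/
theorem exists_coe_eq_of_isIntegral {x : CAlgCl K} (hx : IsIntegral K x) :
    ∃ y : AlgCl K, (y : CAlgCl K) = x := by
  have h1 : IsIntegral (AlgCl K) x := hx.tower_top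
  exact minpoly.mem_range_of_degree_eq_one (AlgCl K) x
    (IsAlgClosed.degree_eq_one_of_irreducible _ (minpoly.irreducible h1))

/-- The finite extension of `K` inside the algebraic closure whose tilt is `E`. -/
noncomputable def untilt : IntermediateField K (AlgCl K) :=
  ((thetaSubalgebra E).comap (IsScalarTower.toAlgHom K (AlgCl K) (CAlgCl K))).toIntermediateField
    fun x hx => Subalgebra.inv_mem_of_algebraic _ (x := ⟨x, hx⟩)
      (Algebra.IsAlgebraic.isAlgebraic (R := K) x)

theorem mem_untilt {x : AlgCl K} : x ∈ untilt E ↔ (x : CAlgCl K) ∈ thetaSubalgebra E := Iff.rfl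

instance finiteDimensional_untilt [FiniteDimensional (PerfectNormField p K) E] :
    FiniteDimensional K (untilt E) := by
  have := finite_thetaSubalgebra E
  let f : untilt E →ₗ[K] thetaSubalgebra E :=
    ((IsScalarTower.toAlgHom K (AlgCl K) (CAlgCl K)).toLinearMap.restrict
      (p := Subalgebra.toSubmodule (untilt E).toSubalgebra)
      (q := Subalgebra.toSubmodule (thetaSubalgebra E)) fun x hx => hx)
  exact FiniteDimensional.of_injective f fun x y h =>
    Subtype.ext (coe_CAlgCl_injective (congrArg Subtype.val h))

variable [FiniteDimensional (PerfectNormField p K) E]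

theorem exists_mem_untilt_eq_sharp {y : NormRing p (CAlgCl K)} (hy : y ∈ intSubring E) :
    ∃ x ∈ untilt E, (x : CAlgCl K) = sharp p (CAlgCl K) y := by
  have hm : sharp p (CAlgCl K) y ∈ thetaSubalgebra E :=
    ⟨0, _, untilt_mem_thetaRange E hy, by rw [pow_zero, one_mul]; rfl⟩
  have := finite_thetaSubalgebra E
  obtain ⟨x, hx⟩ := exists_coe_eq_of_isIntegral <|
    IsIntegral.of_mem_of_fg (thetaSubalgebra E) (Module.Finite.iff_fg.mp this) _ hm
  exact ⟨x, (mem_untilt E).mpr (hx ▸ hm), hx⟩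

/-- Integral elements of the untilt of `E` are congruent modulo `p` to sharps of elements of `E`. -/
theorem exists_norm_coe_sub_sharp_le {x : AlgCl K} (hx : x ∈ untilt E) (hx1 : ‖x‖ ≤ 1) :
    ∃ y ∈ intSubring E, ‖(x : CAlgCl K) - sharp p (CAlgCl K) y‖ ≤ ‖(p : CAlgCl K)‖ := by
  obtain ⟨a, ha, hax⟩ := exists_mem_thetaRange_of_norm_le_one E hx
    ((norm_coe_CAlgCl x).trans_le hx1)
  obtain ⟨y, hy, b, hb, rfl⟩ := exists_eq_untilt_add E ha
  refine ⟨y, hy, ?_⟩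
  change _ = (x : CAlgCl K) at hax
  rw [← hax, ← coe_untilt, ← mk_eq_mk_iff, map_add, map_mul, map_natCast]
  simp

end Untilt

/-! ### The untilts exhaust the algebraic closure -/

section Exhaust

open Polynomial IntermediateField

variable {p : ℕ} [Fact p.Prime]
variable {K : Type u} [NontriviallyNormedField K] [IsAnalyticField K] [IsPerfectoid p K]

theorem untilt_mono {E₁ E₂ : IntermediateField (PerfectNormField p K) (TiltC K p)} (h : E₁ ≤ E₂) :
    untilt E₁ ≤ untilt E₂ := by
  have hi : intSubring E₁ ≤ intSubring E₂ := fun y hy => h hy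
  rintro x ⟨n, a, ⟨w, rfl⟩, hax⟩
  refine ⟨n, _, ⟨WittVector.map (Subring.inclusion hi) w, ?_⟩, hax⟩
  rw [RingHom.comp_apply, RingHom.comp_apply]
  exact congrArg _ (WittVector.ext fun n => rfl)

variable (p K) in
/-- The algebraic closure of `K'` in the tilt of `C`. -/
noncomputable abbrev TiltAlgCl : IntermediateField (PerfectNormField p K) (TiltC K p) :=
  algebraicClosure (PerfectNormField p K) (TiltC K p)

instance : IsAlgClosed (TiltAlgCl p K) :=
  have : IsAlgClosed (TiltC K p) := tiltC_isAlgClosed p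
  (algebraicClosure.isAlgClosure (PerfectNormField p K) (TiltC K p)).isAlgClosed

variable (p K) in
/-- The union of the untilts of all finite extensions of `K'` in the tilt of `C`. -/
noncomputable def untiltUnion : IntermediateField K (AlgCl K) where
  carrier := {x | ∃ E : IntermediateField (PerfectNormField p K) (TiltC K p),
    FiniteDimensional (PerfectNormField p K) E ∧ x ∈ untilt E}
  mul_mem' := by
    rintro x y ⟨E₁, _, h₁⟩ ⟨E₂, _, h₂⟩
    exact ⟨E₁ ⊔ E₂, inferInstance,
      mul_mem (untilt_mono le_sup_left h₁) (untilt_mono le_sup_right h₂)⟩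
  add_mem' := by
    rintro x y ⟨E₁, _, h₁⟩ ⟨E₂, _, h₂⟩
    exact ⟨E₁ ⊔ E₂, inferInstance,
      add_mem (untilt_mono le_sup_left h₁) (untilt_mono le_sup_right h₂)⟩
  algebraMap_mem' x := ⟨⊥, inferInstance, (untilt ⊥).algebraMap_mem x⟩
  inv_mem' := by
    rintro x ⟨E, hE, h⟩
    exact ⟨E, hE, inv_mem h⟩

theorem exists_mem_untiltUnion_eq_sharp {y : NormRing p (CAlgCl K)}
    (hy : y ∈ intSubring (TiltAlgCl p K)) :
    ∃ x ∈ untiltUnion p K, (x : CAlgCl K) = sharp p (CAlgCl K) y := by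
  have hi : IsIntegral (PerfectNormField p K) (algebraMap _ (TiltC K p) y) :=
    (mem_algebraicClosure_iff.mp (mem_intSubring.mp hy)).isIntegral
  have := adjoin.finiteDimensional hi
  obtain ⟨x, hx, h⟩ := exists_mem_untilt_eq_sharp (PerfectNormField p K)⟮algebraMap _ (TiltC K p) y⟯
    (mem_intSubring.mpr (mem_adjoin_simple_self _ _))
  exact ⟨x, ⟨_, this, hx⟩, h⟩

theorem exists_mem_intSubring_norm_sub_le {x : AlgCl K} (hx : x ∈ untiltUnion p K) (hx1 : ‖x‖ ≤ 1) :
    ∃ y ∈ intSubring (TiltAlgCl p K),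
      ‖(x : CAlgCl K) - sharp p (CAlgCl K) y‖ ≤ ‖(p : CAlgCl K)‖ := by
  obtain ⟨E, _, h⟩ := hx
  have : Algebra.IsAlgebraic (PerfectNormField p K) E := Algebra.IsAlgebraic.of_finite _ _
  obtain ⟨y, hy, hxy⟩ := exists_norm_coe_sub_sharp_le E h hx1
  exact ⟨y, le_algebraicClosure (PerfectNormField p K) (TiltC K p) E hy, hxy⟩

theorem perfectNorm_integers :
    (perfectNorm p (CAlgCl K)).Integers (NormRing p (CAlgCl K)) where
  hom_inj := algebraMap_normRing_injective
  map_le_one y := perfectNorm_le_one_iff.mpr ⟨y, rfl⟩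
  exists_of_le_one _ h := perfectNorm_le_one_iff.mp h

/-- A monic polynomial over the integers of the algebraic closure of `K'` has a root there. -/
theorem exists_root_mem_intSubring {f : (intSubring (TiltAlgCl p K))[X]} (hf : f.Monic)
    (hd : f.natDegree ≠ 0) : ∃ y : intSubring (TiltAlgCl p K), f.eval y = 0 := by
  let j : intSubring (TiltAlgCl p K) →+* TiltAlgCl p K :=
    ((algebraMap _ (TiltC K p)).comp (intSubring (TiltAlgCl p K)).subtype).codRestrict
      (TiltAlgCl p K) fun y => y.2
  obtain ⟨w, hw⟩ := IsAlgClosed.exists_root (f.map j) <| by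
    rw [hf.degree_map, degree_eq_natDegree hf.ne_zero]
    exact_mod_cast hd
  have hw' : f.eval₂ ((algebraMap _ (TiltC K p)).comp (intSubring (TiltAlgCl p K)).subtype)
    (w : TiltC K p) = 0 := by
    rw [IsRoot.def, Polynomial.eval_map] at hw
    have := congrArg (algebraMap (TiltAlgCl p K) (TiltC K p)) hw
    rw [map_zero, hom_eval₂] at this
    exact this
  obtain ⟨y, hy⟩ := perfectNorm_integers.exists_of_le_one <| perfectNorm_integers.mem_of_integral
    (x := (w : TiltC K p)) ⟨f.map (intSubring (TiltAlgCl p K)).subtype,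
      hf.map _, by rwa [eval₂_map]⟩
  refine ⟨⟨y, by rw [mem_intSubring, hy]; exact w.2⟩, ?_⟩
  refine Subtype.ext (algebraMap_normRing_injective ?_)
  rw [← hy] at hw'
  have := (eval₂_at_apply (p := f)
    ((algebraMap _ (TiltC K p)).comp (intSubring (TiltAlgCl p K)).subtype)
    ⟨y, by rw [mem_intSubring, hy]; exact w.2⟩).symm.trans hw'
  rw [ZeroMemClass.coe_zero, map_zero]
  exact this

theorem exists_norm_pow_eq {y : NormRing p (CAlgCl K)} (hy : y ∈ intSubring (TiltAlgCl p K)) {d : ℕ}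
    (hd : d ≠ 0) : ∃ c ∈ untiltUnion p K, ‖c‖ ^ d = ‖sharp p (CAlgCl K) y‖ := by
  obtain ⟨z, hz⟩ := exists_root_mem_intSubring
    (monic_X_pow_sub_C (⟨y, hy⟩ : intSubring (TiltAlgCl p K)) hd) (by rwa [natDegree_X_pow_sub_C])
  rw [eval_sub, eval_pow, eval_X, eval_C, sub_eq_zero] at hz
  obtain ⟨c, hc, hcz⟩ := exists_mem_untiltUnion_eq_sharp z.2
  refine ⟨c, hc, ?_⟩
  rw [← norm_coe_CAlgCl, hcz, ← norm_pow, ← map_pow]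
  exact congrArg (fun x => ‖sharp p (CAlgCl K) x‖) (congrArg Subtype.val hz)

/-- The value group of the union of the untilts is divisible. -/
theorem exists_norm_pow_eq_norm {x : AlgCl K} (hx : x ∈ untiltUnion p K) (hx0 : x ≠ 0) {d : ℕ}
    (hd : d ≠ 0) : ∃ c ∈ untiltUnion p K, ‖c‖ ^ d = ‖x‖ := by
  have hx' : (x : CAlgCl K) ≠ 0 := fun h => hx0 (coe_CAlgCl_injective h)
  obtain ⟨n, hn1, hn2⟩ := exists_zpow_mul_norm_mem (p := p) hx'
  have hc : (((p : AlgCl K) ^ n * x : AlgCl K) : CAlgCl K) = (p : CAlgCl K) ^ n * x := by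
    rw [coe_eq_algebraMap, map_mul, map_zpow₀, map_natCast, coe_eq_algebraMap]
  rw [← hc] at hn1 hn2
  obtain ⟨y, hy, hxy⟩ := exists_mem_intSubring_norm_sub_le (p := p)
    (mul_mem (zpow_mem (_root_.natCast_mem (untiltUnion p K) p) n) hx)
      ((norm_coe_CAlgCl _).symm.trans_le hn2)
  have hxy' := norm_eq_of_norm_sub_lt (hxy.trans_lt hn1)
  obtain ⟨c, hc1, hc2⟩ := exists_norm_pow_eq hy hd
  obtain ⟨ϖ, hϖ⟩ := exists_norm_sharp_eq_norm_p p K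
  obtain ⟨b, hb1, hb2⟩ := exists_norm_pow_eq (baseMap_mem (TiltAlgCl p K) ϖ) hd
  rw [sharp_baseMap, norm_algebraMap_CAlgCl, hϖ, ← norm_p_CAlgCl] at hb2
  refine ⟨c * (b ^ n)⁻¹, mul_mem hc1 (inv_mem (zpow_mem hb1 n)), ?_⟩
  have hp : ‖(p : CAlgCl K)‖ ^ n ≠ 0 := zpow_ne_zero _ (norm_p_pos p).ne'
  rw [norm_mul, norm_inv, norm_zpow, mul_pow, inv_pow, ← zpow_natCast (‖b‖ ^ n), ← zpow_mul,
    mul_comm n, zpow_mul, zpow_natCast, hb2, hc2, hxy', hc, norm_mul, norm_zpow, norm_coe_CAlgCl,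
    mul_comm, inv_mul_cancel_left₀ hp]

theorem norm_algEquiv (σ : AlgCl K ≃ₐ[K] AlgCl K) (x : AlgCl K) : ‖σ x‖ = ‖x‖ :=
  (spectralNorm_eq_of_equiv σ x).symm

instance (U : IntermediateField K (AlgCl K)) : IsAlgClosure U (AlgCl K) :=
  ⟨inferInstance, Algebra.IsAlgebraic.tower_top (K := K) U⟩

theorem norm_eq_of_root {U : IntermediateField K (AlgCl K)} {a b : AlgCl K}
    (hb : aeval b (minpoly U a) = 0) (u : U) : ‖b - u‖ = ‖a - u‖ := by
  obtain ⟨σ, rfl⟩ := minpoly.exists_algEquiv_of_root'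
    (Algebra.IsAlgebraic.isAlgebraic (R := U) a) hb
  have h : σ a - u = σ (a - u) := by
    rw [map_sub]
    exact congrArg _ (σ.commutes u).symm
  rw [h]
  exact norm_algEquiv (σ.restrictScalars K) _

/-- The value of a minimal polynomial at `u` is the product of the distances from `u` to the
conjugates, which are all equal. -/
theorem norm_aeval_minpoly {U : IntermediateField K (AlgCl K)} (a : AlgCl K) (u : U) :
    ‖aeval (u : AlgCl K) (minpoly U a)‖ = ‖a - u‖ ^ (minpoly U a).natDegree := by
  have hs : ((minpoly U a).map (algebraMap U (AlgCl K))).Splits := IsAlgClosed.splits _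
  have hm : (minpoly U a).Monic := minpoly.monic (Algebra.IsIntegral.isIntegral a)
  rw [hs.aeval_eq_prod_aroots_of_monic hm, ← coe_nnnorm, ← nnnormHom_apply, map_multiset_prod,
    Multiset.map_map, Multiset.map_congr rfl (g := fun _ => ‖a - u‖₊), Multiset.map_const',
    Multiset.prod_replicate, NNReal.coe_pow, coe_nnnorm, ← natDegree_map (algebraMap U (AlgCl K)),
    hs.natDegree_eq_card_roots]
  intro b hb
  refine NNReal.eq ?_
  change ‖(u : AlgCl K) - b‖ = ‖a - u‖
  rw [norm_sub_rev]
  exact norm_eq_of_root ((mem_aroots.mp hb).2) u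

theorem norm_coeff_minpoly_le_one {U : IntermediateField K (AlgCl K)} {a : AlgCl K} (ha : ‖a‖ ≤ 1)
    (i : ℕ) : ‖((minpoly U a).coeff i : AlgCl K)‖ ≤ 1 := by
  let O : Subring (AlgCl K) := (NormedField.valuation (K := AlgCl K)).integer
  have hO : ∀ {x : AlgCl K}, x ∈ O ↔ ‖x‖ ≤ 1 := fun {x} => by
    rw [Valuation.mem_integer_iff, NormedField.valuation_apply, ← NNReal.coe_le_coe]
    simp
  have hs : ((minpoly U a).map (algebraMap U (AlgCl K))).Splits := IsAlgClosed.splits _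
  have hm : (minpoly U a).Monic := minpoly.monic (Algebra.IsIntegral.isIntegral a)
  have key : ∀ s : Multiset (AlgCl K), (∀ x ∈ s, x ∈ O) →
      ∀ i, (s.map fun x => X - C x).prod.coeff i ∈ O := fun s => by
    induction s using Multiset.induction with
    | empty =>
      intro _ i
      rw [Multiset.map_zero, Multiset.prod_zero, coeff_one]
      split_ifs
      exacts [one_mem _, zero_mem _]
    | cons x s ih =>
      intro h i
      have ih' := ih fun y hy => h y (Multiset.mem_cons_of_mem hy)
      rw [Multiset.map_cons, Multiset.prod_cons, sub_mul, coeff_sub, coeff_C_mul]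
      refine sub_mem ?_ (mul_mem (h x (Multiset.mem_cons_self _ _)) (ih' i))
      cases i with
      | zero => rw [coeff_X_mul_zero]; exact zero_mem _
      | succ i => rw [coeff_X_mul]; exact ih' i
  have h2 := key ((minpoly U a).map (algebraMap U (AlgCl K))).roots (fun b hb => by
    rw [hO]
    have := norm_eq_of_root (U := U) (a := a) ((mem_aroots.mp hb).2) 0
    rw [ZeroMemClass.coe_zero, sub_zero, sub_zero] at this
    rwa [this]) i
  rw [← hs.eq_prod_roots_of_monic (hm.map _), coeff_map, hO] at h2
  exact h2

/-- An integral element of the algebraic closure is approximated by an element of the union of the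
untilts: lift its minimal polynomial modulo `p` to the tilt and take the sharp of a root. -/
theorem exists_norm_sub_pow_le {a : AlgCl K} (ha : ‖a‖ ≤ 1) :
    ∃ u ∈ untiltUnion p K,
      ‖a - u‖ ^ (minpoly (untiltUnion p K) a).natDegree ≤ ‖(p : K)‖ ∧ ‖u‖ ≤ 1 := by
  set Q := minpoly (untiltUnion p K) a with hQ
  have hm : Q.Monic := minpoly.monic (Algebra.IsIntegral.isIntegral a)
  have hd : Q.natDegree ≠ 0 := (minpoly.natDegree_pos (Algebra.IsIntegral.isIntegral a)).ne'
  choose y hy hyQ using fun i => exists_mem_intSubring_norm_sub_le (Q.coeff i).2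
    (norm_coeff_minpoly_le_one ha i)
  let y' : ℕ → intSubring (TiltAlgCl p K) := fun i => ⟨y i, hy i⟩
  have hlt : (∑ i ∈ Finset.range Q.natDegree, C (y' i) * X ^ i).degree <
      (Q.natDegree : WithBot ℕ) :=
    (degree_sum_le _ _).trans_lt <| (Finset.sup_lt_iff (WithBot.bot_lt_coe _)).mpr fun i hi =>
      (degree_C_mul_X_pow_le i _).trans_lt (by exact_mod_cast Finset.mem_range.mp hi)
  obtain ⟨z, hz⟩ := exists_root_mem_intSubring (monic_X_pow_add hlt) (by
    rwa [natDegree_eq_of_degree_eq_some (n := Q.natDegree)]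
    rw [degree_add_eq_left_of_degree_lt] <;> rw [degree_X_pow]
    exact hlt)
  obtain ⟨u, hu, huz⟩ := exists_mem_untiltUnion_eq_sharp z.2
  refine ⟨u, hu, ?_, ?_⟩
  swap
  · rw [← norm_coe_CAlgCl, huz]
    exact norm_sharp_le_one _ _
  rw [← norm_aeval_minpoly a ⟨u, hu⟩, ← norm_coe_CAlgCl, ← hQ, ← norm_p_CAlgCl]
  have e1 : ((aeval u Q : AlgCl K) : CAlgCl K) =
      sharp p (CAlgCl K) z ^ Q.natDegree +
        ∑ i ∈ Finset.range Q.natDegree, ((Q.coeff i : AlgCl K) : CAlgCl K) *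
          sharp p (CAlgCl K) z ^ i := by
    rw [aeval_eq_sum_range, Finset.sum_range_succ, hm.coeff_natDegree, one_smul, add_comm,
      coe_eq_algebraMap, map_add, map_sum, map_pow]
    simp only [Algebra.smul_def, map_mul, map_pow]
    rw [← coe_eq_algebraMap u, huz]
    rfl
  have e2 : ‖sharp p (CAlgCl K) z ^ Q.natDegree +
      ∑ i ∈ Finset.range Q.natDegree, sharp p (CAlgCl K) (y i) * sharp p (CAlgCl K) z ^ i‖
        ≤ ‖(p : CAlgCl K)‖ := by
    have h1 : (z : NormRing p (CAlgCl K)) ^ Q.natDegree +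
        ∑ i ∈ Finset.range Q.natDegree, y i * (z : NormRing p (CAlgCl K)) ^ i = 0 := by
      have := congrArg Subtype.val hz
      simpa [eval_finsetSum, y'] using this
    have h2 : Ideal.Quotient.mk (Ideal.span {(p : ringOfIntegers (CAlgCl K))})
        (PreTilt.untilt (z : NormRing p (CAlgCl K)) ^ Q.natDegree + ∑ i ∈ Finset.range Q.natDegree,
          PreTilt.untilt (y i) * PreTilt.untilt (z : NormRing p (CAlgCl K)) ^ i) =
        Ideal.Quotient.mk _ 0 := by
      simp only [map_add, map_sum, map_mul, map_pow, ← coeff_zero_eq_mk_untilt]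
      simp only [← map_add, ← map_sum, ← map_mul, ← map_pow, h1, map_zero]
    rw [mk_eq_mk_iff] at h2
    simpa [← coe_untilt] using h2
  have e3 : ‖∑ i ∈ Finset.range Q.natDegree,
      (((Q.coeff i : AlgCl K) : CAlgCl K) - sharp p (CAlgCl K) (y i)) * sharp p (CAlgCl K) z ^ i‖
        ≤ ‖(p : CAlgCl K)‖ := by
    refine IsUltrametricDist.norm_sum_le_of_forall_le_of_nonneg (norm_nonneg _) fun i _ => ?_
    rw [norm_mul, norm_pow]
    exact (mul_le_of_le_one_right (norm_nonneg _)
      (pow_le_one₀ (norm_nonneg _) (norm_sharp_le_one _ _))).trans (hyQ i)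
  have e4 : ((aeval u Q : AlgCl K) : CAlgCl K) = (sharp p (CAlgCl K) z ^ Q.natDegree +
      ∑ i ∈ Finset.range Q.natDegree, sharp p (CAlgCl K) (y i) * sharp p (CAlgCl K) z ^ i) +
      ∑ i ∈ Finset.range Q.natDegree,
        (((Q.coeff i : AlgCl K) : CAlgCl K) - sharp p (CAlgCl K) (y i)) *
          sharp p (CAlgCl K) z ^ i := by
    rw [e1, add_assoc, ← Finset.sum_add_distrib]
    congr 1
    exact Finset.sum_congr rfl fun i _ => by ring
  rw [e4]
  exact (IsUltrametricDist.norm_add_le_max _ _).trans (max_le e2 e3)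

theorem norm_sub_le_max_norm {E : Type*} [SeminormedAddCommGroup E] [IsUltrametricDist E]
    (x y : E) : ‖x - y‖ ≤ max ‖x‖ ‖y‖ := by
  rw [sub_eq_add_neg, ← norm_neg y]
  exact IsUltrametricDist.norm_add_le_max x (-y)

/-- An approximation `x` of `a` is improved by approximating `(a - x) / c`, where `c` lies in the
union of the untilts and has the norm of `a - x`. -/
theorem exists_norm_sub_pow_le_mul {a : AlgCl K} {x : AlgCl K} (hx : x ∈ untiltUnion p K) :
    ∃ u ∈ untiltUnion p K, ‖a - u‖ ^ (minpoly (untiltUnion p K) a).natDegree ≤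
      ‖(p : K)‖ * ‖a - x‖ ^ (minpoly (untiltUnion p K) a).natDegree := by
  have hd : (minpoly (untiltUnion p K) a).natDegree ≠ 0 :=
    (minpoly.natDegree_pos (Algebra.IsIntegral.isIntegral a)).ne'
  rcases eq_or_ne (a - x) 0 with h0 | h0
  · exact ⟨x, hx, by rw [h0, norm_zero, zero_pow hd, mul_zero]⟩
  -- A scalar of the same norm as `a - x`, obtained from the value of the minimal polynomial at `x`.
  obtain ⟨c, hc, hcn⟩ : ∃ c ∈ untiltUnion p K, ‖c‖ = ‖a - x‖ := by
    have h1 := norm_aeval_minpoly a (⟨x, hx⟩ : untiltUnion p K)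
    have h2 : aeval x (minpoly (untiltUnion p K) a) ∈ untiltUnion p K := by
      have h3 : aeval x (minpoly (untiltUnion p K) a) =
          algebraMap (untiltUnion p K) (AlgCl K) ((minpoly (untiltUnion p K) a).eval ⟨x, hx⟩) :=
        aeval_algebraMap_apply_eq_algebraMap_eval (A := AlgCl K) (⟨x, hx⟩ : untiltUnion p K) _
      rw [h3]
      exact Subtype.prop _
    obtain ⟨c, hc, hcn⟩ := exists_norm_pow_eq_norm h2
      (norm_ne_zero_iff.mp (h1.trans_ne (pow_ne_zero _ (norm_ne_zero_iff.mpr h0)))) hd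
    exact ⟨c, hc, (pow_left_inj₀ (norm_nonneg _) (norm_nonneg _) hd).mp (hcn.trans h1)⟩
  have hc0 : c ≠ 0 := norm_ne_zero_iff.mp (hcn.trans_ne (norm_ne_zero_iff.mpr h0))
  have hg : ‖(a - x) / c‖ ≤ 1 := by
    rw [norm_div, hcn, div_self (norm_ne_zero_iff.mpr h0)]
  obtain ⟨u, hu, hu1, hu2⟩ := exists_norm_sub_pow_le (p := p) hg
  refine ⟨x + c * u, add_mem hx (mul_mem hc hu), ?_⟩
  have e : a - (x + c * u) = c * ((a - x) / c - u) := by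
    field_simp
    ring
  rw [e, norm_mul, mul_pow, hcn, mul_comm]
  refine mul_le_mul_of_nonneg_right ?_ (by positivity)
  refine (pow_le_pow_of_le_one (norm_nonneg _) ?_ ?_).trans hu1
  · exact (norm_sub_le_max_norm _ _).trans (max_le hg hu2)
  · let f := (minpoly (untiltUnion p K) a).comp
      (C (⟨c, hc⟩ : untiltUnion p K) * X + C ⟨x, hx⟩)
    have hfd : f.natDegree = (minpoly (untiltUnion p K) a).natDegree := by
      rw [natDegree_comp, natDegree_linear, mul_one]
      exact fun h => hc0 (congrArg Subtype.val h)
    rw [← hfd]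
    refine natDegree_le_natDegree (minpoly.degree_le_of_ne_zero _ _ ?_ ?_)
    · intro h
      rw [h, natDegree_zero] at hfd
      exact hd hfd.symm
    · rw [aeval_comp, map_add, map_mul, aeval_X, aeval_C, aeval_C]
      have : algebraMap (untiltUnion p K) (AlgCl K) ⟨c, hc⟩ * ((a - x) / c) +
          algebraMap (untiltUnion p K) (AlgCl K) ⟨x, hx⟩ = a := by
        change c * ((a - x) / c) + x = a
        field_simp
        ring
      rw [this, minpoly.aeval]

/-- An algebraic element `a` is a limit of elements `u` of the union of the untilts. A conjugate of
`a` over the union is as close to `u` as `a` is, so it is equal to `a`. -/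
theorem untiltUnion_eq_top : untiltUnion p K = ⊤ := by
  have := charZero_of_isMixedChar p K
  have : CharZero (untiltUnion p K) := charZero_of_injective_algebraMap
    (algebraMap K (untiltUnion p K)).injective
  have : IsGalois (untiltUnion p K) (AlgCl K) := { }
  rw [eq_top_iff]
  intro a _
  have hd : (minpoly (untiltUnion p K) a).natDegree ≠ 0 :=
    (minpoly.natDegree_pos (Algebra.IsIntegral.isIntegral a)).ne'
  have h1 : ∀ n : ℕ, ∃ u ∈ untiltUnion p K,
      ‖a - u‖ ^ (minpoly (untiltUnion p K) a).natDegree ≤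
        ‖(p : K)‖ ^ n * ‖a‖ ^ (minpoly (untiltUnion p K) a).natDegree := fun n => by
    induction n with
    | zero => exact ⟨0, zero_mem _, by simp⟩
    | succ n ih =>
      obtain ⟨x, hx, hxa⟩ := ih
      obtain ⟨u, hu, hua⟩ := exists_norm_sub_pow_le_mul (a := a) hx
      refine ⟨u, hu, hua.trans ?_⟩
      rw [pow_succ', mul_assoc]
      exact mul_le_mul_of_nonneg_left hxa (norm_nonneg _)
  have h2 : ∀ σ : AlgCl K ≃ₐ[untiltUnion p K] AlgCl K, σ a = a := fun σ => by
    have h3 : (σ a - a) ^ (minpoly (untiltUnion p K) a).natDegree = 0 := by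
      refine eq_zero_of_forall_norm_le (norm_nonneg (p : K)) (norm_p_lt_one p)
        (c := ‖a‖ ^ (minpoly (untiltUnion p K) a).natDegree) fun n => ?_
      obtain ⟨u, hu, hua⟩ := h1 n
      refine le_trans ?_ hua
      rw [norm_pow]
      refine pow_le_pow_left₀ (norm_nonneg _) ?_ _
      have h4 : σ a - a = σ (a - u) - (a - u) := by
        rw [map_sub, show σ u = u from σ.commutes ⟨u, hu⟩]
        ring
      rw [h4]
      refine (norm_sub_le_max_norm _ _).trans (max_le ?_ le_rfl)
      exact (norm_algEquiv (σ.restrictScalars K) _).le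
    exact sub_eq_zero.mp ((pow_eq_zero_iff hd).mp h3)
  obtain ⟨b, hb⟩ := IntermediateField.mem_bot.mp ((InfiniteGalois.mem_bot_iff_fixed a).mpr h2)
  rw [← hb]
  exact b.2

end Exhaust

/-! ### The Galois action on the tilt -/

section Galois

open IntermediateField

variable {p : ℕ} [Fact p.Prime]
variable {K : Type u} [NontriviallyNormedField K] [IsAnalyticField K]

/-- The continuous extension of a `K`-automorphism of the algebraic closure to its completion. -/
noncomputable def act (σ : AlgCl K ≃ₐ[K] AlgCl K) : CAlgCl K →+* CAlgCl K :=
  UniformSpace.Completion.mapRingHom (σ : AlgCl K →+* AlgCl K)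
    (AddMonoidHomClass.isometry_of_norm (σ : AlgCl K →+* AlgCl K) (norm_algEquiv σ)).continuous

theorem continuous_act (σ : AlgCl K ≃ₐ[K] AlgCl K) : Continuous (act σ) :=
  UniformSpace.Completion.continuous_map

@[simp]
theorem act_coe (σ : AlgCl K ≃ₐ[K] AlgCl K) (x : AlgCl K) :
    act σ (x : CAlgCl K) = (σ x : AlgCl K) :=
  UniformSpace.Completion.mapRingHom_coe _ x

theorem norm_act (σ : AlgCl K ≃ₐ[K] AlgCl K) (x : CAlgCl K) : ‖act σ x‖ = ‖x‖ := by
  induction x using UniformSpace.Completion.induction_on with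
  | hp => exact isClosed_eq (continuous_act σ).norm continuous_norm
  | ih x => rw [act_coe, norm_coe_CAlgCl, norm_coe_CAlgCl, norm_algEquiv]

theorem act_algebraMap (σ : AlgCl K ≃ₐ[K] AlgCl K) (x : K) :
    act σ (algebraMap K (CAlgCl K) x) = algebraMap K (CAlgCl K) x := by
  rw [← coe_algebraMap, act_coe, AlgEquiv.commutes]

theorem act_mul (σ τ : AlgCl K ≃ₐ[K] AlgCl K) (x : CAlgCl K) : act (σ * τ) x = act σ (act τ x) := by
  induction x using UniformSpace.Completion.induction_on with
  | hp => exact isClosed_eq (continuous_act _) ((continuous_act σ).comp (continuous_act τ))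
  | ih x => rw [act_coe, act_coe, act_coe, AlgEquiv.mul_apply]

theorem act_one (x : CAlgCl K) : act (1 : AlgCl K ≃ₐ[K] AlgCl K) x = x := by
  induction x using UniformSpace.Completion.induction_on with
  | hp => exact isClosed_eq (continuous_act _) continuous_id
  | ih x => rw [act_coe, AlgEquiv.one_apply]

variable [IsPerfectoid p K]

variable (p) in
/-- The action of the Galois group of `K` on the tilt of `C`. -/
noncomputable def actTilt (σ : AlgCl K ≃ₐ[K] AlgCl K) :
    TiltC K p →ₐ[PerfectNormField p K] TiltC K p where
  __ := perfectNormFieldMap p (act σ) (norm_act σ)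
  commutes' x := perfectNormFieldMap_comp p (algebraMap K (CAlgCl K)) norm_algebraMap_CAlgCl (act σ)
    (norm_act σ) (algebraMap K (CAlgCl K)) norm_algebraMap_CAlgCl (act_algebraMap σ) x

theorem actTilt_apply (σ : AlgCl K ≃ₐ[K] AlgCl K) (x : TiltC K p) :
    actTilt p σ x = perfectNormFieldMap p (act σ) (norm_act σ) x := rfl

theorem actTilt_algebraMap (σ : AlgCl K ≃ₐ[K] AlgCl K) (y : NormRing p (CAlgCl K)) :
    actTilt p σ (algebraMap _ (TiltC K p) y) =
      algebraMap _ (TiltC K p) (normRingMap p (act σ) (norm_act σ) y) :=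
  perfectNormFieldMap_algebraMap p _ _ y

theorem actTilt_mul (σ τ : AlgCl K ≃ₐ[K] AlgCl K) (x : TiltC K p) :
    actTilt p (σ * τ) x = actTilt p σ (actTilt p τ x) :=
  (perfectNormFieldMap_comp p (act τ) (norm_act τ) (act σ) (norm_act σ) (act (σ * τ))
    (norm_act (σ * τ)) (fun x => (act_mul σ τ x).symm) x).symm

theorem actTilt_one (x : TiltC K p) : actTilt p (1 : AlgCl K ≃ₐ[K] AlgCl K) x = x := by
  have h : act (1 : AlgCl K ≃ₐ[K] AlgCl K) = RingHom.id _ := RingHom.ext act_one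
  rw [actTilt_apply]
  simp only [h]
  exact perfectNormFieldMap_id p x

instance : Normal (PerfectNormField p K) (TiltAlgCl p K) :=
  have : IsAlgClosed (TiltC K p) := tiltC_isAlgClosed p
  have := algebraicClosure.isAlgClosure (PerfectNormField p K) (TiltC K p)
  IsAlgClosure.normal _ _

instance : Algebra.IsAlgebraic (PerfectNormField p K) (TiltAlgCl p K) :=
  algebraicClosure.isAlgebraic _ _

instance : IsGalois (PerfectNormField p K) (TiltAlgCl p K) where

instance : IsAlgClosure K (AlgCl K) := ⟨inferInstance, inferInstance⟩

theorem isGalois_AlgCl (p : ℕ) [Fact p.Prime] (K : Type u) [NontriviallyNormedField K]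
    [IsAnalyticField K] [IsPerfectoid p K] : IsGalois K (AlgCl K) :=
  have := charZero_of_isMixedChar p K
  { }

variable (p K) in
/-- The action of the Galois group of `K` on the algebraic closure of `K'` in the tilt of `C`. -/
noncomputable def galTilt : (AlgCl K ≃ₐ[K] AlgCl K) →*
    (TiltAlgCl p K ≃ₐ[PerfectNormField p K] TiltAlgCl p K) :=
  (AlgEquiv.restrictNormalHom (TiltAlgCl p K)).comp
    { toFun := fun σ => AlgEquiv.ofAlgHom (actTilt p σ) (actTilt p σ⁻¹)
        (AlgHom.ext fun x => by
          rw [AlgHom.comp_apply, ← actTilt_mul, mul_inv_cancel, actTilt_one, AlgHom.id_apply])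
        (AlgHom.ext fun x => by
          rw [AlgHom.comp_apply, ← actTilt_mul, inv_mul_cancel, actTilt_one, AlgHom.id_apply])
      map_one' := AlgEquiv.ext fun x => actTilt_one x
      map_mul' := fun σ τ => AlgEquiv.ext fun x => actTilt_mul σ τ x }

theorem coe_galTilt (σ : AlgCl K ≃ₐ[K] AlgCl K) (x : TiltAlgCl p K) :
    (galTilt p K σ x : TiltC K p) = actTilt p σ x :=
  AlgEquiv.restrictNormalHom_apply (TiltAlgCl p K) _ x

theorem exists_algebraMap_eq_or {F : Type u} [NormedField F] [IsAnalyticField F] [IsMixedChar p F]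
    (d : PerfectNormField p F) :
    ∃ y : NormRing p F, algebraMap _ _ y = d ∨ algebraMap _ _ y = d⁻¹ := by
  rcases le_total (perfectNorm p F d) 1 with h | h
  · obtain ⟨y, hy⟩ := perfectNorm_le_one_iff.mp h
    exact ⟨y, .inl hy⟩
  · obtain ⟨y, hy⟩ := perfectNorm_le_one_iff.mp
      ((map_inv₀ (perfectNorm p F) d).trans_le (inv_le_one_of_one_le₀ h))
    exact ⟨y, .inr hy⟩

variable (E : IntermediateField (PerfectNormField p K) (TiltC K p))
  [FiniteDimensional (PerfectNormField p K) E]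

instance : Algebra.IsAlgebraic (PerfectNormField p K) E := Algebra.IsAlgebraic.of_finite _ _

/-- The tilt of a subfield of `C` containing the untilt of `E` contains `E`. -/
theorem mem_range_of_untilt_le {L : Type u} [NormedField L] [IsAnalyticField L] [IsMixedChar p L]
    (f : L →+* CAlgCl K) (hf : ∀ x, ‖f x‖ = ‖x‖) (h : ∀ x ∈ untilt E, ∃ z, f z = (x : CAlgCl K))
    {e : TiltC K p} (he : e ∈ E) : ∃ z, perfectNormFieldMap p f hf z = e := by
  have key : ∀ y ∈ intSubring E, ∃ z, perfectNormFieldMap p f hf z = algebraMap _ _ y := by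
    intro y hy
    obtain ⟨z, rfl⟩ := exists_normRingMap_eq f hf y fun n => by
      obtain ⟨x, hx, hxy⟩ := exists_mem_untilt_eq_sharp E (root_mem_intSubring E hy n)
      obtain ⟨z, hz⟩ := h x hx
      exact ⟨z, hz.trans hxy⟩
    exact ⟨_, perfectNormFieldMap_algebraMap p f hf z⟩
  obtain ⟨y, rfl | hy⟩ := exists_algebraMap_eq_or e
  · exact key y he
  · obtain ⟨z, hz⟩ := key y (by rw [mem_intSubring, hy]; exact inv_mem he)
    exact ⟨z⁻¹, by rw [map_inv₀, hz, hy, inv_inv]⟩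

/-- An automorphism fixing `E` fixes its untilt, since elements of the untilt are `p`-adic
combinations of sharps. -/
theorem apply_eq_of_mem_untilt {σ : AlgCl K ≃ₐ[K] AlgCl K} (h : ∀ e ∈ E, actTilt p σ e = e)
    {x : AlgCl K} (hx : x ∈ untilt E) : σ x = x := by
  have hp0 : (p : AlgCl K) ≠ 0 := by
    intro h0
    refine p_ne_zero (F := CAlgCl K) p ?_
    rw [← map_natCast (algebraMap (AlgCl K) (CAlgCl K)), h0, map_zero]
  have hpn : ‖(p : AlgCl K)‖ = ‖(p : CAlgCl K)‖ := by
    rw [← norm_coe_CAlgCl, coe_eq_algebraMap, map_natCast]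
  have key : ∀ n : ℕ, ∀ x ∈ untilt E, ‖x‖ ≤ 1 → ‖σ x - x‖ ≤ ‖(p : CAlgCl K)‖ ^ n := by
    intro n
    induction n with
    | zero =>
      intro x _ hx1
      rw [pow_zero]
      exact (norm_sub_le_max_norm _ _).trans (max_le ((norm_algEquiv σ x).trans_le hx1) hx1)
    | succ n ih =>
      intro x hx hx1
      obtain ⟨y, hy, hxy⟩ := exists_norm_coe_sub_sharp_le E hx hx1
      obtain ⟨z, hz, hzy⟩ := exists_mem_untilt_eq_sharp E hy
      have hσz : σ z = z := by
        have h1 := h _ (mem_intSubring.mp hy)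
        rw [actTilt_algebraMap] at h1
        have h2 := sharp_normRingMap (act σ) (norm_act σ) y
        rw [algebraMap_normRing_injective h1, ← hzy, act_coe] at h2
        exact (coe_CAlgCl_injective h2).symm
      have h3 := ih ((x - z) / p) (div_mem (sub_mem hx hz) (_root_.natCast_mem _ _)) (by
        rw [norm_div, hpn, div_le_one (norm_p_pos p), ← norm_coe_CAlgCl, coe_eq_algebraMap, map_sub,
          ← coe_eq_algebraMap, ← coe_eq_algebraMap, hzy]
        exact hxy)
      have h4 : σ x - x = p * (σ ((x - z) / p) - (x - z) / p) := by
        rw [map_div₀, map_sub, map_natCast, hσz]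
        field_simp
        ring
      rw [h4, norm_mul, hpn, pow_succ']
      exact mul_le_mul_of_nonneg_left h3 (norm_nonneg _)
  obtain ⟨n, hn1⟩ : ∃ n : ℕ, ‖(p : AlgCl K) ^ n * x‖ ≤ 1 := by
    have h : Filter.Tendsto (fun n : ℕ => ‖(p : CAlgCl K)‖ ^ n * ‖x‖) Filter.atTop
      (nhds (0 * ‖x‖)) :=
      (tendsto_pow_atTop_nhds_zero_of_lt_one (norm_nonneg _) (norm_p_lt_one p)).mul_const _
    rw [zero_mul] at h
    obtain ⟨n, hn⟩ := (h.eventually_le_const zero_lt_one).exists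
    exact ⟨n, by rwa [norm_mul, norm_pow, hpn]⟩
  have h5 : σ ((p : AlgCl K) ^ n * x) - (p : AlgCl K) ^ n * x = 0 :=
    eq_zero_of_forall_norm_le (norm_nonneg _) (norm_p_lt_one (F := CAlgCl K) p) (c := 1) fun m => by
      rw [mul_one]
      exact key m _ (mul_mem (pow_mem (_root_.natCast_mem _ _) _) hx) hn1
  rw [map_mul, map_pow, map_natCast, ← mul_sub] at h5
  exact sub_eq_zero.mp ((mul_eq_zero.mp h5).resolve_left (pow_ne_zero _ hp0))

/-- An automorphism fixing the untilt of `E` fixes `E`. -/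
theorem actTilt_eq_of_forall_untilt {σ : AlgCl K ≃ₐ[K] AlgCl K} (h : ∀ x ∈ untilt E, σ x = x)
    {e : TiltC K p} (he : e ∈ E) : actTilt p σ e = e := by
  have key : ∀ y ∈ intSubring E, actTilt p σ (algebraMap _ _ y) = algebraMap _ _ y := by
    intro y hy
    rw [actTilt_algebraMap]
    refine congrArg _ (normRing_ext fun n => ?_)
    rw [coeff_normRingMap, coeff_eq_mk_untilt_root, modPMap_mk]
    refine congrArg _ (Subtype.ext ?_)
    change act σ (sharp p (CAlgCl K) (root p n y)) = sharp p (CAlgCl K) (root p n y)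
    obtain ⟨x, hx, hxy⟩ := exists_mem_untilt_eq_sharp E (root_mem_intSubring E hy n)
    rw [← hxy, act_coe, h x hx]
  obtain ⟨y, rfl | hy⟩ := exists_algebraMap_eq_or e
  · exact key y he
  · have h1 := key y (by rw [mem_intSubring, hy]; exact inv_mem he)
    rw [hy, map_inv₀] at h1
    exact inv_injective h1

theorem finiteDimensional_lift (E : IntermediateField (PerfectNormField p K) (TiltAlgCl p K))
    [FiniteDimensional (PerfectNormField p K) E] :
    FiniteDimensional (PerfectNormField p K) (IntermediateField.lift E) :=
  LinearEquiv.finiteDimensional (IntermediateField.liftAlgEquiv E).toLinearEquiv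

/-- The stabilizer of a finite extension `E` of `K'` contains that of the untilt of `E`. -/
theorem continuous_galTilt : Continuous (galTilt p K) := by
  refine continuous_of_continuousAt_one _ ?_
  rw [ContinuousAt, map_one]
  intro s hs
  obtain ⟨E, _, hE⟩ := (krullTopology_mem_nhds_one_iff _ _ s).mp hs
  have := finiteDimensional_lift E
  refine (krullTopology_mem_nhds_one_iff _ _ _).mpr
    ⟨untilt (IntermediateField.lift E), inferInstance, fun σ hσ => hE ?_⟩
  rw [SetLike.mem_coe, IntermediateField.mem_fixingSubgroup_iff] at hσ ⊢
  intro x hx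
  refine Subtype.ext ((coe_galTilt σ x).trans ?_)
  exact actTilt_eq_of_forall_untilt _ hσ ((IntermediateField.mem_lift x).mpr hx)

/-- The Galois group of `K` acts faithfully since the untilts exhaust the algebraic closure. -/
theorem galTilt_injective : Function.Injective (galTilt p K) := by
  refine (injective_iff_map_eq_one _).mpr fun σ hσ => AlgEquiv.ext fun x => ?_
  obtain ⟨E, _, hx⟩ : x ∈ untiltUnion p K := untiltUnion_eq_top (p := p) (K := K) ▸ mem_top
  refine apply_eq_of_mem_untilt E (fun e he => ?_) hx
  have := coe_galTilt σ ⟨e, le_algebraicClosure (PerfectNormField p K) (TiltC K p) E he⟩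
  rw [hσ] at this
  exact this.symm

/-- An element `y` fixed by the Galois group of `K` lies in `K'`: the untilt of `K'(y)` is fixed
too, so it is `K`, and the tilt `K'` of `K` contains `K'(y)`. -/
theorem mem_bot_of_forall_galTilt {y : TiltAlgCl p K} (h : ∀ σ, galTilt p K σ y = y) :
    y ∈ (⊥ : IntermediateField (PerfectNormField p K) (TiltAlgCl p K)) := by
  have hi : IsIntegral (PerfectNormField p K) (y : TiltC K p) :=
    (mem_algebraicClosure_iff.mp y.2).isIntegral
  have := adjoin.finiteDimensional hi
  have := isGalois_AlgCl p K
  obtain ⟨z, hz⟩ := mem_range_of_untilt_le (PerfectNormField p K)⟮(y : TiltC K p)⟯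
    (algebraMap K (CAlgCl K)) norm_algebraMap_CAlgCl (fun x hx => by
      have hx' : x ∈ (⊥ : IntermediateField K (AlgCl K)) := by
        refine (InfiniteGalois.mem_bot_iff_fixed x).mpr fun σ =>
          apply_eq_of_mem_untilt _ (fun e he => ?_) hx
        induction he using IntermediateField.adjoin_induction with
        | mem z hz =>
          rw [Set.mem_singleton_iff.mp hz, ← coe_galTilt, h]
        | algebraMap z => exact AlgHom.commutes _ _
        | add a b _ _ ha hb => rw [map_add, ha, hb]
        | inv a _ ha => rw [map_inv₀, ha]
        | mul a b _ _ ha hb => rw [map_mul, ha, hb]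
      obtain ⟨z, hz⟩ := IntermediateField.mem_bot.mp hx'
      exact ⟨z, by rw [← hz, coe_algebraMap]⟩) (mem_adjoin_simple_self _ _)
  exact IntermediateField.mem_bot.mpr ⟨z, Subtype.ext hz⟩

/-- The image of the compact Galois group of `K` is closed and has fixed field `K'`. -/
theorem galTilt_surjective : Function.Surjective (galTilt p K) := by
  have := isGalois_AlgCl p K
  let H : ClosedSubgroup (TiltAlgCl p K ≃ₐ[PerfectNormField p K] TiltAlgCl p K) :=
    { (galTilt p K).range with
      isClosed' := (isCompact_range continuous_galTilt).isClosed }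
  have h1 : fixedField (H : Subgroup (TiltAlgCl p K ≃ₐ[PerfectNormField p K] TiltAlgCl p K)) = ⊥ :=
    eq_bot_iff.mpr fun y hy => mem_bot_of_forall_galTilt fun σ =>
      (mem_fixedField_iff _ _).mp hy _ ⟨σ, rfl⟩
  have h2 := InfiniteGalois.fixingSubgroup_fixedField H
  rw [h1, fixingSubgroup_bot] at h2
  intro τ
  have : τ ∈ (H : Subgroup (TiltAlgCl p K ≃ₐ[PerfectNormField p K] TiltAlgCl p K)) :=
    h2 ▸ Subgroup.mem_top τ
  exact this

variable (p K) in
/-- The isomorphism between the Galois groups of `K` and `K'`. -/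
noncomputable def galTiltEquiv :
    (AlgCl K ≃ₐ[K] AlgCl K) ≃ₜ* (TiltAlgCl p K ≃ₐ[PerfectNormField p K] TiltAlgCl p K) :=
  have := isGalois_AlgCl p K
  let e := MulEquiv.ofBijective (galTilt p K) ⟨galTilt_injective, galTilt_surjective⟩
  have he : Continuous e := continuous_galTilt
  { e with
    continuous_toFun := he
    continuous_invFun := (he.homeoOfEquivCompactToT2 (f := e.toEquiv)).continuous_invFun }

end Galois

/-! ### The tilt of a finite extension -/

section FiniteExtension

open IntermediateField

variable {p : ℕ} [Fact p.Prime]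
variable {K : Type u} [NontriviallyNormedField K] [IsAnalyticField K] [IsPerfectoid p K]

/-- The two actions of an automorphism `σ`, on the untilt of `E` and on `E`, determine each
other. -/
theorem mem_fixingSubgroup_untilt_lift
    (E : IntermediateField (PerfectNormField p K) (TiltAlgCl p K))
    [FiniteDimensional (PerfectNormField p K) E] {σ : AlgCl K ≃ₐ[K] AlgCl K} :
    σ ∈ (untilt (IntermediateField.lift E)).fixingSubgroup ↔
      galTilt p K σ ∈ E.fixingSubgroup := by
  have := finiteDimensional_lift E
  rw [IntermediateField.mem_fixingSubgroup_iff, IntermediateField.mem_fixingSubgroup_iff]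
  constructor
  · intro h x hx
    refine Subtype.ext ((coe_galTilt σ x).trans ?_)
    exact actTilt_eq_of_forall_untilt _ h ((IntermediateField.mem_lift x).mpr hx)
  · intro h x hx
    refine apply_eq_of_mem_untilt (IntermediateField.lift E) (fun e he => ?_) hx
    have he' : (⟨e, IntermediateField.lift_le E he⟩ : TiltAlgCl p K) ∈ E :=
      (IntermediateField.mem_lift _).mp he
    rw [← coe_galTilt σ ⟨e, IntermediateField.lift_le E he⟩, h _ he']

/-- Every finite extension of `K` in its algebraic closure is the untilt of a finite extension
of `K'`. -/
theorem exists_untilt_lift_eq (L : IntermediateField K (AlgCl K)) [FiniteDimensional K L] :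
    ∃ E : IntermediateField (PerfectNormField p K) (TiltAlgCl p K),
      FiniteDimensional (PerfectNormField p K) E ∧ untilt (IntermediateField.lift E) = L := by
  have := isGalois_AlgCl p K
  have hL : IsOpen (L.fixingSubgroup : Set (AlgCl K ≃ₐ[K] AlgCl K)) :=
    IntermediateField.fixingSubgroup_isOpen L
  have hS : IsOpen ((L.fixingSubgroup.map (galTilt p K) :
      Subgroup (TiltAlgCl p K ≃ₐ[PerfectNormField p K] TiltAlgCl p K)) :
      Set (TiltAlgCl p K ≃ₐ[PerfectNormField p K] TiltAlgCl p K)) := by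
    rw [Subgroup.coe_map]
    exact (galTiltEquiv p K).toHomeomorph.isOpenMap _ hL
  let H : ClosedSubgroup (TiltAlgCl p K ≃ₐ[PerfectNormField p K] TiltAlgCl p K) :=
    { L.fixingSubgroup.map (galTilt p K) with
      isClosed' := Subgroup.isClosed_of_isOpen _ hS }
  have hH := InfiniteGalois.fixingSubgroup_fixedField H
  have hE : FiniteDimensional (PerfectNormField p K)
      (fixedField (H : Subgroup (TiltAlgCl p K ≃ₐ[PerfectNormField p K] TiltAlgCl p K))) := by
    rw [← InfiniteGalois.isOpen_iff_finite, hH]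
    exact hS
  refine ⟨_, hE, ?_⟩
  rw [← InfiniteGalois.fixedField_fixingSubgroup (untilt _),
    ← InfiniteGalois.fixedField_fixingSubgroup L]
  congr 1
  ext σ
  rw [mem_fixingSubgroup_untilt_lift, hH]
  exact Subgroup.mem_map_iff_mem galTilt_injective

variable (E : IntermediateField (PerfectNormField p K) (TiltC K p))
  [FiniteDimensional (PerfectNormField p K) E]

/-- A finite extension of `K'` in the tilt of `C` is closed. -/
theorem mem_of_forall_exists_perfectNorm_sub_lt {d : TiltC K p}
    (h : ∀ ε : ℝ, 0 < ε → ∃ e ∈ E, (perfectNorm p (CAlgCl K) (d - e) : ℝ) < ε) : d ∈ E := by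
  let := tiltNontriviallyNormedField p K
  let := tiltNormedField p (CAlgCl K)
  let := tiltNormedAlgebra K p
  have : CompleteSpace (PerfectNormField p K) := tilt_completeSpace
  have : FiniteDimensional (PerfectNormField p K) (Subalgebra.toSubmodule E.toSubalgebra) :=
    inferInstanceAs (FiniteDimensional (PerfectNormField p K) E)
  have hc := (Subalgebra.toSubmodule E.toSubalgebra).closed_of_finiteDimensional
  change d ∈ (Subalgebra.toSubmodule E.toSubalgebra : Set (TiltC K p))
  rw [← hc.closure_eq, Metric.mem_closure_iff]
  intro ε hε
  obtain ⟨e, he, hde⟩ := h ε hε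
  exact ⟨e, he, by rwa [dist_eq_norm]⟩

section Embedding

variable {L : Type u} [NormedField L] [IsAnalyticField L] [IsMixedChar p L]
  (f : L →+* CAlgCl K) (hf : ∀ x, ‖f x‖ = ‖x‖)

/-- The tilt of a subfield of `C` contained in the untilt of `E` is contained in `E`. -/
theorem perfectNormFieldMap_mem (h : ∀ z, ∃ x ∈ untilt E, (x : CAlgCl K) = f z)
    (z : PerfectNormField p L) : perfectNormFieldMap p f hf z ∈ E := by
  have key : ∀ y : NormRing p L, perfectNormFieldMap p f hf (algebraMap _ _ y) ∈ E := by
    intro y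
    rw [perfectNormFieldMap_algebraMap]
    refine mem_of_forall_exists_perfectNorm_sub_lt E fun ε hε => ?_
    obtain ⟨n, hn⟩ :=
      ((tendsto_norm_p_pow_pow (p := p) (F := CAlgCl K)).eventually_lt_const hε).exists
    obtain ⟨x, hx, hxy⟩ := h (sharp p L (root p n y))
    have hx1 : ‖x‖ ≤ 1 := by
      rw [← norm_coe_CAlgCl, hxy, hf]
      exact norm_sharp_le_one _ _
    obtain ⟨w, hw, hxw⟩ := exists_norm_coe_sub_sharp_le E hx hx1
    refine ⟨algebraMap _ _ (w ^ p ^ n), (pow_mem hw _ : w ^ p ^ n ∈ intSubring E), ?_⟩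
    refine lt_of_le_of_lt ?_ hn
    rw [← map_sub, perfectNorm_algebraMap, coe_nnnorm, ← coeff_eq_zero_iff_norm_sharp, map_sub,
      sub_eq_zero, coeff_eq_mk_untilt_root, coeff_eq_mk_untilt_root, root_pow_pow,
      root_normRingMap, mk_eq_mk_iff, coe_untilt, coe_untilt, sharp_normRingMap, ← hxy]
    exact hxw
  obtain ⟨y, rfl | hy⟩ := exists_algebraMap_eq_or z
  · exact key y
  · have := inv_mem (key y)
    rwa [hy, map_inv₀, inv_inv] at this

/-- A field identified with the untilt of `E` is perfectoid: its integers are congruent modulo `p`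
to sharps, which are `p`-th powers. -/
theorem isPerfectoid_of_untilt (i : K →+* L) (hi : ∀ x, ‖i x‖ = ‖x‖) (hf : ∀ x, ‖f x‖ = ‖x‖)
    (h : ∀ x : CAlgCl K, (∃ z, f z = x) ↔ ∃ y ∈ untilt E, (y : CAlgCl K) = x) :
    IsPerfectoid p L where
  not_discrete := fun ⟨r, hr, hd⟩ => IsPerfectoid.not_discrete p (K := K)
    ⟨r, hr, fun x hx => by
      rw [← hi]
      exact hd _ ((map_ne_zero i).mpr hx)⟩
  frobenius_surjective a := by
    obtain ⟨a, rfl⟩ := Ideal.Quotient.mk_surjective a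
    obtain ⟨x, hx, hxa⟩ := (h _).mp ⟨(a : L), rfl⟩
    obtain ⟨y, hy, hxy⟩ := exists_norm_coe_sub_sharp_le E hx <| by
      rw [← norm_coe_CAlgCl, hxa, hf]
      exact norm_coe_le_one a
    obtain ⟨b, hb⟩ := (h _).mpr (exists_mem_untilt_eq_sharp E (root_mem_intSubring E hy 1))
    have hb1 : ‖b‖ ≤ 1 := by
      rw [← hf, hb]
      exact norm_sharp_le_one _ _
    refine ⟨Ideal.Quotient.mk _ ⟨b, mem_ringOfIntegers.mpr hb1⟩, ?_⟩
    change _ ^ p = _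
    rw [← map_pow, eq_comm, mk_eq_mk_iff]
    have hp : ‖(p : L)‖ = ‖(p : CAlgCl K)‖ := by rw [← hf, map_natCast]
    have hby : sharp p (CAlgCl K) (root p 1 y) ^ p = sharp p (CAlgCl K) y := by
      simpa using sharp_root_pow 1 y
    rw [hp, ← hf, map_sub, SubmonoidClass.coe_pow, map_pow, hb, hby, ← hxa]
    exact hxy

end Embedding

end FiniteExtension

end AnalyticField

namespace FinExt

open AnalyticField IntermediateField

variable {K : Type u} [NontriviallyNormedField K] [IsAnalyticField K]

/-- The map from a finite extension of `K` to `C` induced by an embedding in the algebraic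
closure. -/
noncomputable def toCAlgCl {L : FinExt K} (ι : L →ₐ[K] AlgCl K) : L →+* CAlgCl K :=
  (algebraMap (AlgCl K) (CAlgCl K)).comp (ι : L →+* AlgCl K)

theorem toCAlgCl_apply {L : FinExt K} (ι : L →ₐ[K] AlgCl K) (x : L) :
    toCAlgCl ι x = (ι x : CAlgCl K) := rfl

theorem norm_algHom_AlgCl {L : FinExt K} (ι : L →ₐ[K] AlgCl K) (x : L) : ‖ι x‖ = ‖x‖ := by
  rw [FinExt.norm_def, AlgCl.norm_def, spectralNorm, spectralNorm,
    minpoly.algHom_eq ι (ι : L →+* AlgCl K).injective]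

theorem norm_toCAlgCl {L : FinExt K} (ι : L →ₐ[K] AlgCl K) (x : L) : ‖toCAlgCl ι x‖ = ‖x‖ := by
  rw [toCAlgCl_apply, norm_coe_CAlgCl, norm_algHom_AlgCl]

variable (p : ℕ) [Fact p.Prime] [IsPerfectoid p K]

/-- The map from the tilt of a finite extension of `K` to the tilt of `C`. -/
noncomputable def toTiltC {L : FinExt K} (ι : L →ₐ[K] AlgCl K) :
    PerfectNormField p L →ₐ[PerfectNormField p K] TiltC K p where
  __ := AnalyticField.perfectNormFieldMap p (toCAlgCl ι) (norm_toCAlgCl ι)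
  commutes' x := perfectNormFieldMap_comp p (algebraMap K L) L.norm_algebraMap (toCAlgCl ι)
    (norm_toCAlgCl ι) (algebraMap K (CAlgCl K)) norm_algebraMap_CAlgCl
    (fun x => by rw [toCAlgCl_apply, ι.commutes, coe_algebraMap]) x

theorem exists_toCAlgCl_eq_iff {L : FinExt K} {ι : L →ₐ[K] AlgCl K}
    {E : IntermediateField (PerfectNormField p K) (TiltC K p)} (h : untilt E = ι.fieldRange)
    (x : CAlgCl K) : (∃ z, toCAlgCl ι z = x) ↔ ∃ y ∈ untilt E, (y : CAlgCl K) = x := by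
  rw [h]
  constructor
  · rintro ⟨z, rfl⟩
    exact ⟨ι z, ⟨z, rfl⟩, rfl⟩
  · rintro ⟨_, ⟨z, rfl⟩, rfl⟩
    exact ⟨z, rfl⟩

/-- If `L` is embedded onto the untilt of `E`, then its tilt is embedded onto `E`. -/
theorem fieldRange_toTiltC {L : FinExt K} {ι : L →ₐ[K] AlgCl K}
    {E : IntermediateField (PerfectNormField p K) (TiltC K p)}
    [FiniteDimensional (PerfectNormField p K) E] (h : untilt E = ι.fieldRange) :
    (toTiltC p ι).fieldRange = E := by
  have h' := exists_toCAlgCl_eq_iff p h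
  refine le_antisymm ?_ fun e he => ?_
  · rintro _ ⟨z, rfl⟩
    exact perfectNormFieldMap_mem E (toCAlgCl ι) (norm_toCAlgCl ι) (fun z => (h' _).mp ⟨z, rfl⟩) z
  · obtain ⟨z, hz⟩ := mem_range_of_untilt_le E (toCAlgCl ι) (norm_toCAlgCl ι)
      (fun x hx => (h' _).mpr ⟨x, hx, rfl⟩) he
    exact ⟨z, hz⟩

/-- A finite extension, embedded in the algebraic closure, is the untilt of a finite extension
of `K'`. -/
theorem exists_untilt_eq_fieldRange {L : FinExt K} (ι : L →ₐ[K] AlgCl K) :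
    ∃ E : IntermediateField (PerfectNormField p K) (TiltC K p),
      FiniteDimensional (PerfectNormField p K) E ∧ untilt E = ι.fieldRange := by
  have : FiniteDimensional K ι.fieldRange := ι.equivFieldRange.toLinearEquiv.finiteDimensional
  obtain ⟨E, hE, h⟩ := exists_untilt_lift_eq (p := p) ι.fieldRange
  exact ⟨IntermediateField.lift E, finiteDimensional_lift E, h⟩

theorem isPerfectoid (L : FinExt K) : IsPerfectoid p L := by
  let ι : L →ₐ[K] AlgCl K := IsAlgClosed.lift
  obtain ⟨E, hE, h⟩ := exists_untilt_eq_fieldRange p ι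
  exact isPerfectoid_of_untilt E (toCAlgCl ι) (algebraMap K L) L.norm_algebraMap (norm_toCAlgCl ι)
    (exists_toCAlgCl_eq_iff p h)

theorem finiteDimensional_perfectNormField (L : FinExt K) :
    FiniteDimensional (PerfectNormField p K) (PerfectNormField p L) := by
  let ι : L →ₐ[K] AlgCl K := IsAlgClosed.lift
  obtain ⟨E, hE, h⟩ := exists_untilt_eq_fieldRange p ι
  rw [← fieldRange_toTiltC p h] at hE
  exact (toTiltC p ι).equivFieldRange.symm.toLinearEquiv.finiteDimensional

end FinExt

namespace AnalyticField

/-! ### Embeddings of perfectoid fields -/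

/-- An isometric embedding of a perfectoid field is determined by its tilt: this fixes the embedding
on sharps, and integral elements are `p`-adic sums of sharps. -/
theorem ringHom_eq_of_perfectNormFieldMap_eq {p : ℕ} [Fact p.Prime] {F E : Type u} [NormedField F]
    [IsAnalyticField F] [NormedField E] [IsAnalyticField E] [IsPerfectoid p F] [IsMixedChar p E]
    {f g : F →+* E} (hf : ∀ x, ‖f x‖ = ‖x‖) (hg : ∀ x, ‖g x‖ = ‖x‖)
    (h : ∀ z, perfectNormFieldMap p f hf z = perfectNormFieldMap p g hg z) : f = g := by
  have hs : ∀ y, f (sharp p F y) = g (sharp p F y) := fun y => by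
    have := h (algebraMap _ _ y)
    rw [perfectNormFieldMap_algebraMap, perfectNormFieldMap_algebraMap] at this
    rw [← sharp_normRingMap f hf, ← sharp_normRingMap g hg, algebraMap_normRing_injective this]
  have hpn : ‖(p : E)‖ = ‖(p : F)‖ := by rw [← hf, map_natCast]
  have key : ∀ n : ℕ, ∀ x : F, ‖x‖ ≤ 1 → ‖f x - g x‖ ≤ ‖(p : F)‖ ^ n := by
    intro n
    induction n with
    | zero =>
      intro x hx
      rw [pow_zero]
      exact (norm_sub_le_max_norm _ _).trans
        (max_le ((hf x).trans_le hx) ((hg x).trans_le hx))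
    | succ n ih =>
      intro x hx
      obtain ⟨y, hy⟩ := exists_norm_sub_sharp_le (p := p) hx
      have h1 := ih ((x - sharp p F y) / p) (by rwa [norm_div, div_le_one (norm_p_pos p)])
      have hp0 := p_ne_zero (F := E) p
      have h2 : f x - g x = p * (f ((x - sharp p F y) / p) - g ((x - sharp p F y) / p)) := by
        rw [map_div₀, map_sub, map_natCast, map_div₀, map_sub, map_natCast, hs]
        field_simp
        ring
      rw [h2, norm_mul, hpn, pow_succ']
      exact mul_le_mul_of_nonneg_left h1 (norm_nonneg _)
  have hint : ∀ x : F, ‖x‖ ≤ 1 → f x = g x := fun x hx => sub_eq_zero.mp <|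
    eq_zero_of_forall_norm_le (norm_nonneg _) (norm_p_lt_one (F := F) p) (c := 1) fun m => by
      rw [mul_one]
      exact key m x hx
  refine RingHom.ext fun x => ?_
  rcases le_total ‖x‖ 1 with hx | hx
  · exact hint x hx
  · have := hint x⁻¹ (by rw [norm_inv]; exact inv_le_one_of_one_le₀ hx)
    rwa [map_inv₀, map_inv₀, inv_inj] at this

end AnalyticField

/-! ### Topological Galois groups of isomorphic extensions -/

/-- The group of automorphisms of an extension, with the Krull topology, only depends on the
isomorphism class of the extension. -/
theorem AlgEquiv.continuous_autCongr {k A B : Type*} [Field k] [Field A] [Field B] [Algebra k A]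
    [Algebra k B] (φ : A ≃ₐ[k] B) : Continuous (AlgEquiv.autCongr φ) := by
  refine continuous_of_continuousAt_one (AlgEquiv.autCongr φ) ?_
  rw [ContinuousAt, map_one]
  intro s hs
  obtain ⟨E, hE, hEs⟩ := (krullTopology_mem_nhds_one_iff _ _ s).mp hs
  refine (krullTopology_mem_nhds_one_iff _ _ _).mpr
    ⟨E.map (φ.symm : B →ₐ[k] A),
      (E.equivMap (φ.symm : B →ₐ[k] A)).toLinearEquiv.finiteDimensional, fun σ hσ => hEs ?_⟩
  rw [SetLike.mem_coe, IntermediateField.mem_fixingSubgroup_iff] at hσ ⊢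
  intro x hx
  have := hσ (φ.symm x) ⟨x, hx, rfl⟩
  change φ (σ (φ.symm x)) = x
  rw [this, AlgEquiv.apply_symm_apply]

/-- Isomorphic extensions have isomorphic topological automorphism groups. -/
noncomputable def AlgEquiv.continuousAutCongr {k A B : Type*} [Field k] [Field A] [Field B]
    [Algebra k A] [Algebra k B] (φ : A ≃ₐ[k] B) : (A ≃ₐ[k] A) ≃ₜ* (B ≃ₐ[k] B) where
  __ := AlgEquiv.autCongr φ
  continuous_toFun := AlgEquiv.continuous_autCongr φ
  continuous_invFun := AlgEquiv.continuous_autCongr φ.symm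

/-! ### Tilting as a functor -/

namespace FinExt

open AnalyticField IntermediateField

variable {K : Type u} [NontriviallyNormedField K] [IsAnalyticField K]
variable {p : ℕ} [Fact p.Prime] [IsPerfectoid p K]

set_option synthInstance.maxHeartbeats 200000 in
instance : Module.IsTorsionFree (PerfectNormField p K) (TiltAlgCl p K) := inferInstance

set_option synthInstance.maxHeartbeats 200000 in
instance : Module.IsTorsionFree (PerfectNormField p K) (TiltC K p) := inferInstance

theorem toTiltC_perfectNormFieldMap {L M : FinExt K} (f : L →ₐ[K] M) (ι : L →ₐ[K] AlgCl K)
    (κ : M →ₐ[K] AlgCl K) (h : ∀ x, κ (f x) = ι x) (z : PerfectNormField p L) :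
    toTiltC p κ (perfectNormFieldMap p f z) = toTiltC p ι z :=
  perfectNormFieldMap_comp p (f : L →+* M) (norm_algHom f) (toCAlgCl κ) (norm_toCAlgCl κ)
    (toCAlgCl ι)
    (norm_toCAlgCl ι) (fun x => by rw [toCAlgCl_apply, toCAlgCl_apply, ← h]; rfl) z

theorem toTiltC_comp_algEquiv {L : FinExt K} (ι : L →ₐ[K] AlgCl K) (σ : AlgCl K ≃ₐ[K] AlgCl K)
    (z : PerfectNormField p L) :
    toTiltC p ((σ : AlgCl K →ₐ[K] AlgCl K).comp ι) z = actTilt p σ (toTiltC p ι z) :=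
  (perfectNormFieldMap_comp p (toCAlgCl ι) (norm_toCAlgCl ι) (act σ) (norm_act σ) _
    (norm_toCAlgCl _)
    (fun x => by rw [toCAlgCl_apply, toCAlgCl_apply, act_coe]; rfl) z).symm

theorem algHom_mem_tiltAlgCl {L : FinExt K}
    (β : PerfectNormField p L →ₐ[PerfectNormField p K] TiltC K p)
    (z : PerfectNormField p L) : β z ∈ TiltAlgCl p K := by
  have := finiteDimensional_perfectNormField p L
  exact mem_algebraicClosure_iff.mpr (IsAlgebraic.algHom β (Algebra.IsAlgebraic.isAlgebraic z))

theorem untilt_fieldRange_toTiltC {L : FinExt K} (ι : L →ₐ[K] AlgCl K) :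
    untilt (toTiltC p ι).fieldRange = ι.fieldRange := by
  obtain ⟨E, hE, h⟩ := exists_untilt_eq_fieldRange p ι
  rw [fieldRange_toTiltC p h, h]

/-- Two embeddings of the tilt of `L` in the tilt of `C` differ by an automorphism of the
algebraic closure of `K`. -/
theorem exists_toTiltC_eq {L : FinExt K}
    (β : PerfectNormField p L →ₐ[PerfectNormField p K] TiltC K p) :
    ∃ ι : L →ₐ[K] AlgCl K, ∀ z, toTiltC p ι z = β z := by
  have := finiteDimensional_perfectNormField p L
  let ι : L →ₐ[K] AlgCl K := IsAlgClosed.lift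
  let α' : PerfectNormField p L →ₐ[PerfectNormField p K] TiltAlgCl p K :=
    (toTiltC p ι).codRestrict (TiltAlgCl p K).toSubalgebra (algHom_mem_tiltAlgCl _)
  let β' : PerfectNormField p L →ₐ[PerfectNormField p K] TiltAlgCl p K :=
    β.codRestrict (TiltAlgCl p K).toSubalgebra (algHom_mem_tiltAlgCl β)
  obtain ⟨τ, hτ⟩ := IntermediateField.exists_algHom_of_splits (L := α'.fieldRange)
    (E := TiltAlgCl p K) (fun s => ⟨Algebra.IsIntegral.isIntegral s, IsAlgClosed.splits _⟩)
    (β'.comp α'.equivFieldRange.symm.toAlgHom)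
  obtain ⟨σ, hσ⟩ := galTilt_surjective
    (AlgEquiv.ofBijective τ (Algebra.IsAlgebraic.algHom_bijective τ))
  refine ⟨(σ : AlgCl K →ₐ[K] AlgCl K).comp ι, fun z => ?_⟩
  have h1 : τ (α' z) = β' z := (DFunLike.congr_fun hτ (α'.equivFieldRange z)).trans
    (congrArg β' (α'.equivFieldRange.symm_apply_apply z))
  have h2 := coe_galTilt σ (α' z)
  rw [hσ] at h2
  rw [toTiltC_comp_algEquiv]
  exact h2.symm.trans (congrArg Subtype.val h1)

/-- The tilting functor is full: a morphism of tilts comes from an embedding of `L` in the algebraic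
closure, whose image is contained in that of `M` because this holds for the tilts. -/
theorem exists_perfectNormFieldMap_eq {L M : FinExt K}
    (φ : PerfectNormField p L →ₐ[PerfectNormField p K] PerfectNormField p M) :
    ∃ f : L →ₐ[K] M, perfectNormFieldMap p f = φ := by
  let κ : M →ₐ[K] AlgCl K := IsAlgClosed.lift
  obtain ⟨ι, hι⟩ := exists_toTiltC_eq ((toTiltC p κ).comp φ)
  have hle : ι.fieldRange ≤ κ.fieldRange := by
    have := finiteDimensional_perfectNormField p L
    rw [← untilt_fieldRange_toTiltC (p := p) ι, ← untilt_fieldRange_toTiltC (p := p) κ]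
    refine untilt_mono ?_
    rintro _ ⟨z, rfl⟩
    exact ⟨φ z, (hι z).symm⟩
  let f : L →ₐ[K] M := (κ.equivFieldRange.symm : κ.fieldRange →ₐ[K] M).comp
    ((IntermediateField.inclusion hle).comp (ι.equivFieldRange : L →ₐ[K] ι.fieldRange))
  have hf : ∀ x, κ (f x) = ι x := fun x =>
    congrArg Subtype.val (κ.equivFieldRange.apply_symm_apply _)
  refine ⟨f, AlgHom.ext fun z => (toTiltC p κ).injective ?_⟩
  exact (toTiltC_perfectNormFieldMap f ι κ hf z).trans (hι z)

theorem nonempty_algEquiv_of_untilt_eq {L : FinExt K} {ι : L →ₐ[K] AlgCl K}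
    {E : IntermediateField (PerfectNormField p K) (TiltC K p)}
    [FiniteDimensional (PerfectNormField p K) E] (h : untilt E = ι.fieldRange) :
    Nonempty (PerfectNormField p L ≃ₐ[PerfectNormField p K] E) :=
  ⟨(toTiltC p ι).equivFieldRange.trans (IntermediateField.equivOfEq (fieldRange_toTiltC p h))⟩

/-- The tilting functor is essentially surjective: an extension of `K'`, embedded in `C'`, is the
tilt of its untilt. -/
theorem exists_nonempty_algEquiv (X : FinExt (PerfectNormField p K)) :
    ∃ L : FinExt K, Nonempty (PerfectNormField p L ≃ₐ[PerfectNormField p K] X) := by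
  have : IsAlgClosed (TiltC K p) := tiltC_isAlgClosed p
  let j : X →ₐ[PerfectNormField p K] TiltC K p := IsAlgClosed.lift
  have : FiniteDimensional (PerfectNormField p K) j.fieldRange :=
    j.equivFieldRange.toLinearEquiv.finiteDimensional
  obtain ⟨L, ι, h⟩ : ∃ (L : FinExt K) (ι : L →ₐ[K] AlgCl K), untilt j.fieldRange = ι.fieldRange :=
    ⟨{ carrier := untilt j.fieldRange }, (untilt j.fieldRange).val, (fieldRange_val _).symm⟩
  obtain ⟨e⟩ := nonempty_algEquiv_of_untilt_eq h
  exact ⟨_, ⟨e.trans j.equivFieldRange.symm⟩⟩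

/-- An isomorphism of extensions of `k` is an isomorphism in the category of extensions. -/
def isoOfAlgEquiv {k : Type u} [Field k] {X Y : FinExt k} (e : X ≃ₐ[k] Y) : X ≅ Y where
  hom := e.toAlgHom
  inv := e.symm.toAlgHom
  hom_inv_id := AlgHom.ext e.symm_apply_apply
  inv_hom_id := AlgHom.ext e.apply_symm_apply

theorem isEquivalence_perfectNormFunctor : (perfectNormFunctor (K := K) p
    (finiteDimensional_perfectNormField p)).IsEquivalence where
  faithful := ⟨fun {L M f g} h => by
    have := isPerfectoid p L
    have h' := ringHom_eq_of_perfectNormFieldMap_eq (p := p) (norm_algHom (f : L →ₐ[K] M))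
      (norm_algHom (g : L →ₐ[K] M)) fun z => DFunLike.congr_fun (F := AlgHom _ _ _) h z
    exact AlgHom.coe_ringHom_injective h'⟩
  full := ⟨fun φ => exists_perfectNormFieldMap_eq φ⟩
  essSurj := ⟨fun X => by
    obtain ⟨L, ⟨e⟩⟩ := exists_nonempty_algEquiv X
    exact ⟨L, ⟨isoOfAlgEquiv e⟩⟩⟩

end FinExt

theorem theoremT (p : ℕ) [Fact p.Prime] (K : Type u) [NontriviallyNormedField K]
    [IsAnalyticField K] [AnalyticField.IsPerfectoid p K] :
    (∀ L : FinExt K, AnalyticField.IsPerfectoid p L) ∧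
    (∃ h : ∀ L : FinExt K, FiniteDimensional (AnalyticField.PerfectNormField p K)
        (AnalyticField.PerfectNormField p L),
      (FinExt.perfectNormFunctor p h).IsEquivalence) ∧
    (∀ (L : FinExt K) (x : AnalyticField.PerfectNormField p K),
      AnalyticField.perfectNorm p L (algebraMap _ (AnalyticField.PerfectNormField p L) x) =
        AnalyticField.perfectNorm p K x) ∧
    Nonempty (Field.absoluteGaloisGroup K ≃ₜ*
      Field.absoluteGaloisGroup (AnalyticField.PerfectNormField p K)) := by
  open AnalyticField in
  refine ⟨FinExt.isPerfectoid p, ⟨FinExt.finiteDimensional_perfectNormField p,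
    FinExt.isEquivalence_perfectNormFunctor⟩, fun L x =>
    perfectNorm_map (algebraMap K L) L.norm_algebraMap x, ⟨?_⟩⟩
  have : IsAlgClosed (TiltC K p) := tiltC_isAlgClosed p
  have := algebraicClosure.isAlgClosure (PerfectNormField p K) (TiltC K p)
  exact ((AlgCl.equiv K).continuousAutCongr.trans (galTiltEquiv p K)).trans
    (IsAlgClosure.equiv (PerfectNormField p K) (TiltAlgCl p K)
      (AlgebraicClosure (PerfectNormField p K))).continuousAutCongr
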